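/- Let $q\ge p\ge 1$ be integers. Let $S$ be the group of complex lower triangular $p\times p$ matrices with real positive diagonal entries, and let $N$ be the Heisenberg group of pairs $(n,z)$, where $n$ is a skew-Hermitian $p\times p$ matrix and $z$ is a complex $p\times(q-p)$ matrix, with $(n_1,z_1)(n_2,z_2)=(n_1+n_2-\tfrac12(z_1z_2^*-z_2z_1^*),\,z_1+z_2)$. The group $S$ acts on $N$ by the automorphisms $(n,z)\mapsto(n,z)^s=(sns^*,sz)$; the Iwasawa group is the semidirect product $P=S\rightthreetimes N$, with $s\,g\,s^{-1}=g^s$. Let $Z=\mathbb C^{p\times(q-p)}$ carry the normalized Gaussian measure $d\mu(z)=\pi^{-p(q-p)}e^{-\operatorname{tr}zz^*}dz$, and let $K\subset L^2(Z,\mu)$ be the Bargmann space of holomorphic functions, $\mathbf 1\in K$ the constant function, on which $N$ acts unitarily by $$(U(n_0,z_0)\varphi)(z)=e^{\operatorname{tr}(n_0-\frac12z_0z_0^*-zz_0^*)}\varphi(z+z_0).$$ A $\sigma$-finite Borel measure $\nu$ on $S$ is called almost invariant if for every $s_0\in S$ the measure $d\nu(ss_0)$ is equivalent to $d\nu(s)$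 and $\frac{d\nu(ss_0)}{d\nu(s)}$ is bounded. For functions $\Phi$ on $S$ whose values are functions on $Z$, and for $g\in N$, $s_0\in S$, put $$(T(g s_0)\Phi)(s)=U(g^s)\,\Phi(ss_0).$$ A strongly continuous (not necessarily unitary) representation $T$ of a topological group $G$ by bounded operators in a Hilbert space $H$ is called special if there is a nontrivial $1$-cocycle, i.e. a continuous map $\beta:G\to H$ with $\beta(g_1g_2)=T(g_1)\beta(g_2)+\beta(g_1)$ that is not of the form $\beta(g)=T(g)\xi-\xi$, $\xi\in H$. Theorem. (a) Let $\nu$ be an almost invariant measure on $S$ for which there is a measurable function $f:S\to(0,\infty)$ such that (i) $\int_S f(s)^2\,d\nu(s)=\infty$; (ii) $\int_S|f(ss_0)-f(s)|^2\,d\nu(s)<\infty$ for every $s_0\in S$; (iii) $\int_S\bigl(1-\operatorname{Re}e^{\operatorname{tr}(s(n_0-\frac12z_0z_0^*)s^*)}\bigr)f(s)^2\,d\nu(s)<\infty$ for every $(n_0,z_0)\in N$. Then the formula for $T$ above defines a unique representation $T$ of $P$ by bounded operators in $L^2(S,\nu;K)$; the formula $$\beta(x)=T(x)(f\mathbf 1)-f\mathbf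 1,\qquad x\in P,$$ (where $T(x)$ acts on the function $f\mathbf 1$ by the same formula) defines a map $\beta:P\to L^2(S,\nu;K)$, which is a nontrivial continuous $1$-cocycle of $T$; and thus $T$ is special. (b) Let $|s|^2=\operatorname{tr}(ss^*)$ and let $ds$ be the Lebesgue measure on $S$ in the coordinates $s_{ii}>0$, $s_{ij}\in\mathbb C$ ($i>j$). Then $d\nu(s)=|s|^{-p^2}ds$ is a $\sigma$-finite almost invariant measure on $S$, and $\nu$ and $f(s)=e^{-\frac12|s|^2}$ satisfy conditions (i)–(iii). -/

import Mathlib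

open MeasureTheory Matrix
open scoped ENNReal NNReal

namespace Iwasawa

/-! ### The group `S` of lower triangular matrices with positive diagonal -/

lemma mul_diag_of_lower {p : ℕ} {A B : Matrix (Fin p) (Fin p) ℂ}
    (hA : A.BlockTriangular OrderDual.toDual) (hB : B.BlockTriangular OrderDual.toDual)
    (i : Fin p) : (A * B) i i = A i i * B i i := by
  rw [Matrix.mul_apply]
  refine Finset.sum_eq_single i (fun j _ hj => ?_) (fun h => absurd (Finset.mem_univ i) h)
  rcases lt_or_gt_of_ne hj with h | h
  · rw [hB (OrderDual.toDual_lt_toDual.2 h), mul_zero]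
  · rw [hA (OrderDual.toDual_lt_toDual.2 h), zero_mul]

/-- The group `S` of complex lower triangular `p × p` matrices whose diagonal entries are real
and positive, as a (topological) subgroup of `GL(p, ℂ)`. -/
def lowerTri (p : ℕ) : Subgroup (GL (Fin p) ℂ) where
  carrier := {g | (∀ i j : Fin p, i < j → g.val i j = 0) ∧
    ∀ i : Fin p, 0 < (g.val i i).re ∧ (g.val i i).im = 0}
  one_mem' := by
    refine ⟨fun i j h => ?_, fun i => ?_⟩
    · simp [Matrix.one_apply_ne h.ne]
    · simp
  mul_mem' := by
    rintro a b ⟨ha, ha'⟩ ⟨hb, hb'⟩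
    have hA : a.val.BlockTriangular OrderDual.toDual := fun i j h => ha i j h
    have hB : b.val.BlockTriangular OrderDual.toDual := fun i j h => hb i j h
    refine ⟨fun i j h => ?_, fun i => ?_⟩
    · exact (hA.mul hB) (OrderDual.toDual_lt_toDual.2 h)
    · have h := mul_diag_of_lower hA hB i
      rw [Units.val_mul, h, Complex.mul_re, Complex.mul_im, (ha' i).2, (hb' i).2]
      simpa using mul_pos (ha' i).1 (hb' i).1
  inv_mem' := by
    rintro a ⟨ha, ha'⟩
    have hA : a.val.BlockTriangular OrderDual.toDual := fun i j h => ha i j h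
    have hB : (a⁻¹).val.BlockTriangular OrderDual.toDual := by
      rw [Matrix.coe_units_inv]
      let : Invertible a.val := a.invertible
      exact Matrix.blockTriangular_inv_of_blockTriangular hA
    refine ⟨fun i j h => hB (OrderDual.toDual_lt_toDual.2 h), fun i => ?_⟩
    have h := mul_diag_of_lower hA hB i
    rw [Units.mul_inv, Matrix.one_apply_eq] at h
    have hre : a.val i i = (((a.val i i).re : ℝ) : ℂ) := by
      apply Complex.ext <;> simp [(ha' i).2]
    have hinv : (a⁻¹).val i i = ((((a.val i i).re)⁻¹ : ℝ) : ℂ) := by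
      rw [Complex.ofReal_inv, ← hre]
      exact eq_inv_of_mul_eq_one_right h.symm
    rw [hinv, Complex.ofReal_re, Complex.ofReal_im]
    exact ⟨inv_pos.2 (ha' i).1, rfl⟩

noncomputable instance (p : ℕ) : MeasurableSpace (lowerTri p) := borel _

instance (p : ℕ) : BorelSpace (lowerTri p) := ⟨rfl⟩

/-- The matrix of an element of `S`. -/
noncomputable def mat {p : ℕ} (s : lowerTri p) : Matrix (Fin p) (Fin p) ℂ := (s : GL (Fin p) ℂ).val

lemma mat_one {p : ℕ} : mat (1 : lowerTri p) = 1 := rfl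

lemma mat_mul {p : ℕ} (s t : lowerTri p) : mat (s * t) = mat s * mat t := rfl

/-! ### The Heisenberg group `N` -/

/-- The Heisenberg group `N`: pairs `(n, z)` with `n` a skew-Hermitian `p × p` matrix and `z` a
complex `p × m` matrix (`m = q - p` for the group `U(p, q)`). -/
@[ext]
structure Heis (p m : ℕ) where
  n : skewAdjoint (Matrix (Fin p) (Fin p) ℂ)
  z : Matrix (Fin p) (Fin m) ℂ

namespace Heis

variable {p m : ℕ}

/-- The skew-Hermitian matrix `½ (z₁ z₂* - z₂ z₁*)`. -/
noncomputable def form (z₁ z₂ : Matrix (Fin p) (Fin m) ℂ) :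
    skewAdjoint (Matrix (Fin p) (Fin p) ℂ) :=
  ⟨(1 / 2 : ℂ) • (z₁ * z₂ᴴ - z₂ * z₁ᴴ), by
    rw [skewAdjoint.mem_iff, Matrix.star_eq_conjTranspose, Matrix.conjTranspose_smul,
      Matrix.conjTranspose_sub, Matrix.conjTranspose_mul, Matrix.conjTranspose_mul,
      Matrix.conjTranspose_conjTranspose, Matrix.conjTranspose_conjTranspose, ← smul_neg, neg_sub]
    simp⟩

/-- `(n₁, z₁) (n₂, z₂) = (n₁ + n₂ - ½ (z₁ z₂* - z₂ z₁*), z₁ + z₂)`. -/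
noncomputable instance : Mul (Heis p m) := ⟨fun a b => ⟨a.n + b.n - form a.z b.z, a.z + b.z⟩⟩

instance : One (Heis p m) := ⟨⟨0, 0⟩⟩

instance : Inv (Heis p m) := ⟨fun a => ⟨-a.n, -a.z⟩⟩

lemma mul_n (a b : Heis p m) : (a * b).n = a.n + b.n - form a.z b.z := rfl
lemma mul_z (a b : Heis p m) : (a * b).z = a.z + b.z := rfl
lemma one_n : (1 : Heis p m).n = 0 := rfl
lemma one_z : (1 : Heis p m).z = 0 := rfl
lemma inv_n (a : Heis p m) : (a⁻¹).n = -a.n := rfl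
lemma inv_z (a : Heis p m) : (a⁻¹).z = -a.z := rfl

noncomputable instance : Group (Heis p m) :=
  Group.ofLeftAxioms
    (by
      intro a b c
      ext1
      · apply Subtype.ext
        simp only [mul_n, mul_z, form, AddSubgroup.coe_add, AddSubgroup.coe_sub,
          Matrix.conjTranspose_add, Matrix.add_mul, Matrix.mul_add]
        module
      · simp only [mul_z, add_assoc])
    (by
      intro a
      ext1
      · apply Subtype.ext
        simp [mul_n, one_n, one_z, form]
      · simp [mul_z, one_z])
    (by
      intro a
      ext1
      · apply Subtype.ext
        simp [mul_n, inv_n, inv_z, one_n, form]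
      · simp [mul_z, inv_z, one_z])

/-- The topology of `N` as a product of two finite-dimensional real vector spaces. -/
noncomputable instance : TopologicalSpace (Heis p m) :=
  TopologicalSpace.induced (fun g => (g.n, g.z)) inferInstance

/-- The action of `s ∈ S` on `N`: `(n, z) ↦ (s n s*, s z)`. -/
noncomputable def conj (s : lowerTri p) (g : Heis p m) : Heis p m :=
  ⟨⟨mat s * g.n * (mat s)ᴴ, by
    have h := skewAdjoint.mem_iff.1 g.n.2
    rw [Matrix.star_eq_conjTranspose] at h
    rw [skewAdjoint.mem_iff, Matrix.star_eq_conjTranspose, Matrix.conjTranspose_mul,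
      Matrix.conjTranspose_mul, Matrix.conjTranspose_conjTranspose, h]
    simp [Matrix.mul_assoc]⟩, mat s * g.z⟩

lemma conj_one (g : Heis p m) : conj 1 g = g := by
  ext1
  · apply Subtype.ext
    simp [conj, mat_one]
  · simp [conj, mat_one]

lemma conj_mul_left (s t : lowerTri p) (g : Heis p m) : conj (s * t) g = conj s (conj t g) := by
  ext1
  · apply Subtype.ext
    simp [conj, mat_mul, Matrix.mul_assoc]
  · simp [conj, mat_mul, Matrix.mul_assoc]

lemma conj_mul_right (s : lowerTri p) (g h : Heis p m) :
    conj s (g * h) = conj s g * conj s h := by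
  ext1
  · apply Subtype.ext
    simp [conj, mul_n, form, Matrix.mul_assoc, Matrix.mul_add, Matrix.add_mul, Matrix.mul_sub,
      Matrix.sub_mul]
  · simp [conj, mul_z, Matrix.mul_add]

/-- The action of `S` on `N` by automorphisms, as a homomorphism. -/
noncomputable def act (p m : ℕ) : lowerTri p →* MulAut (Heis p m) where
  toFun s :=
    { toFun := conj s
      invFun := conj s⁻¹
      left_inv := fun g => by rw [← conj_mul_left, inv_mul_cancel, conj_one]
      right_inv := fun g => by rw [← conj_mul_left, mul_inv_cancel, conj_one]
      map_mul' := conj_mul_right s }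
  map_one' := by
    ext1 g
    exact conj_one g
  map_mul' s t := by
    ext1 g
    exact conj_mul_left s t g

end Heis

/-- The Iwasawa group `P = S ⋌ N`. An element is a pair `(g, s)`, `g ∈ N`, `s ∈ S`, standing for
the product `g s`, and `s g s⁻¹ = Heis.conj s g`. -/
abbrev IwasawaGroup (p m : ℕ) : Type := Heis p m ⋊[Heis.act p m] lowerTri p

/-- The product topology on `P`. -/
noncomputable instance (p m : ℕ) : TopologicalSpace (IwasawaGroup p m) :=
  TopologicalSpace.induced (fun g => (g.left, g.right)) inferInstance

/-! ### The Bargmann space and the representation of `N` in it -/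

/-- The space `Z` of complex `p × m` matrices, as a measure space and a normed space. -/
abbrev ZSpace (p m : ℕ) : Type := Fin p → Fin m → ℂ

/-- The Gaussian measure `π ^ (-pm) e ^ (-tr z z*) dz` on `Z`, normalized to total mass one. -/
noncomputable def gauss (p m : ℕ) : Measure (ZSpace p m) :=
  volume.withDensity fun z =>
    ENNReal.ofReal ((Real.pi ^ (p * m))⁻¹ * Real.exp (-∑ i, ∑ j, ‖z i j‖ ^ 2))

/-- The Bargmann space `K`: the subspace of `L²(Z, gauss)` of (classes of) holomorphic functions. -/
noncomputable def bargmann (p m : ℕ) : Submodule ℂ (Lp ℂ 2 (gauss p m)) where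
  carrier := {h | ∃ F : ZSpace p m → ℂ, Differentiable ℂ F ∧ ⇑h =ᵐ[gauss p m] F}
  zero_mem' := ⟨fun _ => 0, differentiable_const 0, Lp.coeFn_zero _ _ _⟩
  add_mem' := by
    rintro a b ⟨F, hF, haF⟩ ⟨G, hG, hbG⟩
    exact ⟨F + G, hF.add hG, (Lp.coeFn_add a b).trans (haF.add hbG)⟩
  smul_mem' := by
    rintro c a ⟨F, hF, haF⟩
    exact ⟨c • F, hF.const_smul c, (Lp.coeFn_smul c a).trans (haF.const_smul c)⟩

/-- The value at `z` of a vector of the Bargmann space (defined for almost every `z`). -/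
noncomputable def bargmannFun {p m : ℕ} (h : bargmann p m) : ZSpace p m → ℂ :=
  ⇑(h : Lp ℂ 2 (gauss p m))

/-- The operator of `g = (n₀, z₀) ∈ N`:
`(T(g) φ)(z) = exp (tr (n₀ - ½ z₀ z₀* - z z₀*)) φ(z + z₀)`. -/
noncomputable def heisOp {p m : ℕ} (g : Heis p m) (φ : ZSpace p m → ℂ) : ZSpace p m → ℂ :=
  fun z => Complex.exp (Matrix.trace
      ((g.n : Matrix (Fin p) (Fin p) ℂ) - (1 / 2 : ℂ) • (g.z * g.zᴴ) - Matrix.of z * g.zᴴ)) *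
    φ (fun i j => z i j + g.z i j)

/-! ### The representation of `P` associated with an almost invariant measure -/

/-- A measure `ν` on `S` is almost invariant if for every `s₀` the measure `dν(s s₀)` (that is,
`E ↦ ν (E s₀)`) is equivalent to `ν` and the derivative `dν(s s₀) / dν(s)` is bounded. -/
def AlmostInvariant {p : ℕ} (ν : Measure (lowerTri p)) : Prop :=
  ∀ s₀ : lowerTri p, (ν.map fun s => s * s₀⁻¹) ≪ ν ∧ ν ≪ (ν.map fun s => s * s₀⁻¹) ∧
    ∃ C : ℝ≥0, ∀ᵐ s ∂ν, (ν.map fun s => s * s₀⁻¹).rnDeriv ν s ≤ C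

/-- The direct integral over `(S, ν)` of the Bargmann spaces `K_s = K`, i.e. `L²(S, ν; K)`. -/
abbrev DirectIntegral {p : ℕ} (m : ℕ) (ν : Measure (lowerTri p)) : Type :=
  Lp (bargmann p m) 2 ν

/-- The action of `P` on arbitrary functions `Φ(s)(z)`: an element `s₀` of `S` acts by
`Φ(s) ↦ Φ(s s₀)`, and an element `g` of `N` acts for each `s` by the operator of `s g s⁻¹`. -/
noncomputable def actFun {p m : ℕ} (x : IwasawaGroup p m) (Φ : lowerTri p → ZSpace p m → ℂ) :
    lowerTri p → ZSpace p m → ℂ :=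
  fun s => heisOp (Heis.conj s x.left) (Φ (s * x.right))

/-- `T` is the representation of `P` in `L²(S, ν; K)` by bounded operators given by `actFun`. -/
def IsAssociatedRep {p m : ℕ} (ν : Measure (lowerTri p))
    (T : IwasawaGroup p m →* (DirectIntegral m ν →L[ℂ] DirectIntegral m ν)) : Prop :=
  ∀ (x : IwasawaGroup p m) (F : DirectIntegral m ν), ∀ᵐ s ∂ν, ∀ᵐ z ∂(gauss p m),
    bargmannFun (T x F s) z = actFun x (fun t => bargmannFun (F t)) s z

/-! ### Cocycles and special representations -/

section Special

variable {G : Type*} [Group G] [TopologicalSpace G]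
  {H : Type*} [NormedAddCommGroup H] [InnerProductSpace ℂ H]

/-- `β` is a nontrivial (continuous) 1-cocycle of the representation `T`. -/
structure IsNontrivialCocycle (T : G →* (H →L[ℂ] H)) (β : G → H) : Prop where
  continuous : Continuous β
  cocycle : ∀ g₁ g₂, β (g₁ * g₂) = T g₁ (β g₂) + β g₁
  nontrivial : ¬ ∃ ξ : H, ∀ g, β g = T g ξ - ξ

/-- A representation of a topological group is strongly continuous. -/
def StronglyContinuous (T : G →* (H →L[ℂ] H)) : Prop :=
  ∀ v : H, Continuous fun g => T g v

/-- A (not necessarily unitary, strongly continuous) representation is special if it has a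
nontrivial 1-cocycle. -/
def IsSpecial (T : G →* (H →L[ℂ] H)) : Prop :=
  StronglyContinuous T ∧ ∃ β : G → H, IsNontrivialCocycle T β

end Special

/-- The three conditions on a positive function `f` on `S` (with `m = q - p`). -/
structure CocycleConditions {p : ℕ} (m : ℕ) (ν : Measure (lowerTri p)) (f : lowerTri p → ℝ) :
    Prop where
  measurable : Measurable f
  pos : ∀ s, 0 < f s
  not_sq_integrable : ∫⁻ s, ENNReal.ofReal (f s ^ 2) ∂ν = ∞
  translate : ∀ s₀ : lowerTri p, ∫⁻ s, ENNReal.ofReal (|f (s * s₀) - f s| ^ 2) ∂ν < ∞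
  heis : ∀ g : Heis p m, ∫⁻ s, ENNReal.ofReal
    ((1 - (Complex.exp (Matrix.trace (mat s *
      ((g.n : Matrix (Fin p) (Fin p) ℂ) - (1 / 2 : ℂ) • (g.z * g.zᴴ)) * (mat s)ᴴ))).re) *
        f s ^ 2) ∂ν < ∞

/-! ### The example -/

/-- The coordinates on `S`: the real diagonal entries and the complex entries below the diagonal. -/
noncomputable def coords {p : ℕ} (s : lowerTri p) :
    (Fin p → ℝ) × ({ij : Fin p × Fin p // ij.2 < ij.1} → ℂ) :=
  (fun i => (mat s i i).re, fun ij => mat s ij.1.1 ij.1.2)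

/-- The Lebesgue measure `ds` on `S`. -/
noncomputable def lebesgue (p : ℕ) : Measure (lowerTri p) :=
  Measure.comap coords volume

/-- `|s| = (tr s s*) ^ (1/2)`. -/
noncomputable def hsNorm {p : ℕ} (s : lowerTri p) : ℝ :=
  Real.sqrt (∑ i, ∑ j, ‖mat s i j‖ ^ 2)

/-- The measure `|s| ^ (-p²) ds` on `S`. -/
noncomputable def exampleMeasure (p : ℕ) : Measure (lowerTri p) :=
  (lebesgue p).withDensity fun s => ENNReal.ofReal ((hsNorm s ^ (p ^ 2))⁻¹)

/-- The function `e ^ (-|s|² / 2)` on `S`. -/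
noncomputable def exampleFun {p : ℕ} (s : lowerTri p) : ℝ := Real.exp (-(hsNorm s ^ 2) / 2)

end Iwasawa

/-! The operators of `N` are isometric because the squared modulus of their multiplier is the ratio
of the translated Gaussian density to the original one (`norm_heisMul_sq`). Right translations are
bounded in L²(S, ν; K) because the translated measure is dominated by a multiple of ν. Together
these give T, and the formula prescribes T(x)F almost everywhere, whence uniqueness.

Formally β is the coboundary of f·1, so the cocycle identity is automatic once β takes values in L².
At s, with U the operator of sgs⁻¹, it equals (f(ss₀) − f(s)) U1 + f(s) (U1 − 1). Condition (ii)
controls the first term. Condition (iii) controls the second, since ‖U1 − 1‖² = 2(1 − Re⟨1, U1⟩) and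
a Gaussian mean value computation evaluates the coefficient (`inner_heisK_one`,
`memLp_vacuumFun_sub`).

If β were the coboundary of ξ, then f·1 − ξ would be fixed by P. The elements (it, 0) act at s by
the scalar exp(it|s|²), and t = 1, √2 already force f·1 = ξ almost everywhere, against (i)
(`iwasawaCocycle_nontrivial`).

Continuity of T and β comes without estimates: on a second countable locally compact group, a
cocycle in a separable space whose distances are measurable is continuous, by a Steinhaus argument
(`continuous_cocycle_of_measurable`). Measurability follows from Tonelli.

In the example, S is an open cone in a real space of dimension p² on which right multiplications are
linear, so almost invariance amounts to comparing |ss₀| with |s|. The measure is invariant under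
homotheties, with radial part dr/r: this makes e^(-r²) non-integrable at the origin, which is (i),
while the integrands of (ii) and (iii) are bounded by a multiple of r² e^(-cr²)
(`lintegral_hsNorm_sq_mul_exp_lt_top`). -/

namespace Iwasawa

/-! ### Automatic continuity of measurable cocycles and representations. -/

section AutomaticContinuity

open Filter Topology Measure Pointwise

variable {G : Type*} [Group G] [TopologicalSpace G] [IsTopologicalGroup G] [LocallyCompactSpace G]
  [SecondCountableTopology G] [MeasurableSpace G] [BorelSpace G]
  {H : Type*} [NormedAddCommGroup H] [SecondCountableTopology H]

/-- A cocycle of a second countable locally compact group with respect to a family `T` of bounded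
additive operators of a separable space is continuous as soon as all relevant distances are
measurable. -/
theorem continuous_cocycle_of_measurable (T : G → H → H) (β : G → H)
    (h_one : ∀ v, T 1 v = v) (hsub : ∀ g v w, T g (v - w) = T g v - T g w)
    (hb : ∀ g, ∃ C : ℝ, ∀ v, ‖T g v‖ ≤ C * ‖v‖)
    (hT : ∀ v, Measurable fun g => ‖T g v‖) (hβ : ∀ w, Measurable fun g => ‖β g - w‖)
    (hc : ∀ g₁ g₂, β (g₁ * g₂) = T g₁ (β g₂) + β g₁) : Continuous β := by
  let μ : Measure G := haar
  have hμ : μ ≠ 0 := NeZero.ne μ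
  have h1 : β 1 = 0 := by
    have h := hc 1 1
    rw [mul_one, h_one] at h
    simpa using h
  have hcont : ∀ g, Continuous (T g) := fun g => by
    obtain ⟨C, hC⟩ := hb g
    refine (LipschitzWith.of_dist_le_mul (K := C.toNNReal) fun v w => ?_).continuous
    rw [dist_eq_norm, dist_eq_norm, ← hsub]
    exact (hC _).trans (mul_le_mul_of_nonneg_right (Real.le_coe_toNNReal C) (norm_nonneg _))
  have hbound : ∀ (g : G) (c : ℝ), (∀ k, ‖T g (TopologicalSpace.denseSeq H k)‖ ≤
      c * ‖TopologicalSpace.denseSeq H k‖) → ∀ v, ‖T g v‖ ≤ c * ‖v‖ := by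
    intro g c h v
    have := hcont g
    refine (TopologicalSpace.denseRange_denseSeq H).induction_on
      (p := fun v => ‖T g v‖ ≤ c * ‖v‖) v ?_ h
    exact isClosed_le (by fun_prop) (by fun_prop)
  -- Steinhaus argument at the identity: on some set A of positive Haar measure the operators are
  -- uniformly bounded and g ↦ β(g⁻¹) varies by less than 2δ, so β is small on the neighbourhood A/A
  -- of 1.
  have hone : Tendsto β (𝓝 1) (𝓝 0) := by
    -- A fixed bound of the operators on a set of positive measure.
    let F : ℕ → Set G := fun n => {g | ∀ k, ‖T g (TopologicalSpace.denseSeq H k)‖ ≤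
      n * ‖TopologicalSpace.denseSeq H k‖}
    have hFm : ∀ n, MeasurableSet (F n) := fun n => by
      have : F n = ⋂ k, {g | ‖T g (TopologicalSpace.denseSeq H k)‖ ≤
          n * ‖TopologicalSpace.denseSeq H k‖} := by ext; simp [F]
      rw [this]
      exact MeasurableSet.iInter fun k => measurableSet_le (hT _) measurable_const
    have hFu : ⋃ n, F n = Set.univ := by
      refine Set.eq_univ_of_forall fun g => Set.mem_iUnion.2 ?_
      obtain ⟨C, hC⟩ := hb g
      obtain ⟨n, hn⟩ := exists_nat_ge C
      exact ⟨n, fun k => (hC _).trans (mul_le_mul_of_nonneg_right hn (norm_nonneg _))⟩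
    obtain ⟨n, hn⟩ : ∃ n, μ (F n) ≠ 0 := by
      by_contra! h
      exact hμ (Measure.measure_univ_eq_zero.1 (hFu ▸ measure_iUnion_null h))
    rw [Metric.tendsto_nhds]
    intro ε hε
    -- The final bound is n · 2δ; using n + 1 avoids division by zero and makes the inequality
    -- strict.
    let δ : ℝ := ε / (2 * (n + 1))
    have hδ : 0 < δ := by positivity
    let A : ℕ → Set G := fun k => F n ∩ {g | ‖β g⁻¹ - TopologicalSpace.denseSeq H k‖ < δ}
    have hAm : ∀ k, MeasurableSet (A k) := fun k =>
      (hFm n).inter (measurableSet_lt ((hβ _).comp continuous_inv.measurable) measurable_const)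
    have hAu : ⋃ k, A k = F n := by
      refine Set.Subset.antisymm (Set.iUnion_subset fun k => Set.inter_subset_left) fun g hg => ?_
      obtain ⟨_, hk, k, rfl⟩ := Metric.dense_iff.1 (TopologicalSpace.denseRange_denseSeq H)
        (β g⁻¹) δ hδ
      refine Set.mem_iUnion.2 ⟨k, hg, ?_⟩
      rw [Metric.mem_ball, dist_comm, dist_eq_norm] at hk
      exact hk
    obtain ⟨k, hk⟩ : ∃ k, μ (A k) ≠ 0 := by
      by_contra! h
      exact hn (hAu ▸ measure_iUnion_null h)
    filter_upwards [div_mem_nhds_one_of_haar_pos μ (A k) (hAm k) (pos_iff_ne_zero.2 hk)]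
    rintro _ ⟨x, hx, y, hy, rfl⟩
    -- From 0 = β(x x⁻¹) one gets β(x) = −T(x) β(x⁻¹), so only values of β at inverses remain.
    have hxy : β (x / y) = T x (β y⁻¹ - β x⁻¹) := by
      have h2 := hc x x⁻¹
      rw [mul_inv_cancel, h1] at h2
      rw [div_eq_mul_inv, hc, hsub, eq_neg_of_add_eq_zero_right h2.symm, sub_eq_add_neg]
    have hd : ‖β y⁻¹ - β x⁻¹‖ < 2 * δ := by
      have h := norm_sub_le (β y⁻¹ - TopologicalSpace.denseSeq H k)
        (β x⁻¹ - TopologicalSpace.denseSeq H k)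
      rw [sub_sub_sub_cancel_right] at h
      have := hx.2
      have := hy.2
      simp only [Set.mem_ofPred_eq] at *
      linarith
    rw [dist_zero_right, hxy]
    calc ‖T x (β y⁻¹ - β x⁻¹)‖ ≤ n * ‖β y⁻¹ - β x⁻¹‖ := hbound x n hx.1 _
      _ ≤ n * (2 * δ) := by gcongr
      _ < (n + 1) * (2 * δ) := by gcongr; linarith
      _ = ε := by simp only [δ]; field_simp
  refine continuous_iff_continuousAt.2 fun g => ?_
  -- The cocycle identity carries continuity from 1 to g.
  have h : Tendsto (fun x => T g (β (g⁻¹ * x)) + β g) (𝓝 g) (𝓝 (T g 0 + β g)) := by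
    refine (((hcont g).tendsto 0).comp (hone.comp ?_)).add_const _
    have : Tendsto (fun x => g⁻¹ * x) (𝓝 g) (𝓝 (g⁻¹ * g)) :=
      (continuous_const_mul g⁻¹).tendsto g
    rwa [inv_mul_cancel] at this
  have h0 : T g 0 = 0 := by simpa using hsub g 0 0
  rw [h0, zero_add] at h
  refine h.congr fun x => ?_
  rw [← hc, mul_inv_cancel_left]

/-- A representation by bounded operators of a second countable locally compact group in a
separable space is strongly continuous as soon as all relevant distances are measurable. -/
theorem continuous_apply_of_measurable (T : G → H → H) (h_one : ∀ v, T 1 v = v)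
    (h_mul : ∀ g₁ g₂ v, T (g₁ * g₂) v = T g₁ (T g₂ v))
    (hsub : ∀ g v w, T g (v - w) = T g v - T g w)
    (hb : ∀ g, ∃ C : ℝ, ∀ v, ‖T g v‖ ≤ C * ‖v‖)
    (hT : ∀ v w, Measurable fun g => ‖T g v - w‖) (v : H) : Continuous fun g => T g v := by
  -- A coboundary is a cocycle, so the previous theorem applies to it.
  have h : Continuous fun g => T g v - v := by
    refine continuous_cocycle_of_measurable T _ h_one hsub hb (fun v => by simpa using hT v 0)
      (fun w => by simpa only [sub_sub] using hT v (v + w)) fun g₁ g₂ => ?_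
    rw [h_mul, hsub]
    abel
  simpa using h.add_const v

end AutomaticContinuity

/-! ### Linear coordinates on `S` and its topology. -/

section Coordinates

open Topology

/-- The real vector space of the coordinates on `S`. -/
abbrev CoordSpace (p : ℕ) : Type := (Fin p → ℝ) × ({ij : Fin p × Fin p // ij.2 < ij.1} → ℂ)

/-- The lower triangular matrix with the given coordinates. -/
noncomputable def toLower (p : ℕ) : CoordSpace p →ₗ[ℝ] Matrix (Fin p) (Fin p) ℂ where
  toFun v := Matrix.of fun i j =>
    if h : j < i then v.2 ⟨(i, j), h⟩ else if i = j then (v.1 i : ℂ) else 0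
  map_add' v w := by
    ext i j
    simp only [Matrix.of_apply, Matrix.add_apply, Prod.fst_add, Prod.snd_add, Pi.add_apply]
    split_ifs <;> simp
  map_smul' c v := by
    ext i j
    simp only [Matrix.of_apply, Matrix.smul_apply, Prod.smul_fst, Prod.smul_snd, Pi.smul_apply,
      RingHom.id_apply]
    split_ifs <;> simp

/-- The coordinates of a matrix, read off from its lower triangular part. -/
noncomputable def ofLower (p : ℕ) : Matrix (Fin p) (Fin p) ℂ →ₗ[ℝ] CoordSpace p where
  toFun A := (fun i => (A i i).re, fun ij => A ij.1.1 ij.1.2)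
  map_add' A B := by ext <;> simp
  map_smul' c A := by ext <;> simp

variable {p : ℕ}

lemma mat_eq_zero (s : lowerTri p) {i j : Fin p} (h : i < j) : mat s i j = 0 := s.2.1 i j h

lemma mat_diag_pos (s : lowerTri p) (i : Fin p) : 0 < (mat s i i).re := (s.2.2 i).1

lemma mat_diag (s : lowerTri p) (i : Fin p) : mat s i i = ((mat s i i).re : ℂ) :=
  Complex.ext rfl (s.2.2 i).2

lemma mat_injective : Function.Injective (mat : lowerTri p → _) :=
  fun _ _ h => Subtype.ext (Units.ext h)

lemma toLower_coords (s : lowerTri p) : toLower p (coords s) = mat s := by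
  ext i j
  simp only [toLower, coords, LinearMap.coe_mk, AddHom.coe_mk, Matrix.of_apply]
  split_ifs with h h'
  · rfl
  · rw [← h', ← mat_diag]
  · rw [mat_eq_zero s (lt_of_le_of_ne (not_lt.1 h) h')]

lemma exists_coords_eq {v : CoordSpace p} (hv : ∀ i, 0 < v.1 i) :
    ∃ s : lowerTri p, coords s = v := by
  have hdiag : ∀ i, toLower p v i i = (v.1 i : ℂ) := fun i => by simp [toLower]
  have hup : ∀ i j, i < j → toLower p v i j = 0 := fun i j h => by
    simp [toLower, h.not_gt, h.ne]
  have hdet : (toLower p v).det ≠ 0 := by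
    rw [Matrix.det_of_isLowerTriangular _ fun i j h => hup i j h]
    exact Finset.prod_ne_zero_iff.2 fun i _ => by
      rw [hdiag]; exact_mod_cast (hv i).ne'
  refine ⟨⟨Matrix.GeneralLinearGroup.mkOfDetNeZero _ hdet, hup, fun i => ?_⟩, ?_⟩
  · change 0 < (toLower p v i i).re ∧ (toLower p v i i).im = 0
    rw [hdiag]
    exact ⟨hv i, Complex.ofReal_im _⟩
  · change ofLower p (toLower p v) = v
    refine Prod.ext (funext fun i => ?_) (funext fun h => ?_)
    · simp [ofLower, toLower]
    · simp [ofLower, toLower, h.2]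

lemma range_coords : Set.range (coords : lowerTri p → _) = {v | ∀ i, 0 < v.1 i} := by
  ext v
  exact ⟨by rintro ⟨s, rfl⟩ i; exact mat_diag_pos s i, exists_coords_eq⟩

section

attribute [local instance] Matrix.linftyOpNormedRing Matrix.linftyOpNormedAlgebra

/-- In a complete normed ring the units carry the subspace topology; the local norm on matrices
serves only to invoke this. -/
lemma isEmbedding_mat : IsEmbedding (mat : lowerTri p → _) :=
  (Units.isOpenEmbedding_val (R := Matrix (Fin p) (Fin p) ℂ)).isEmbedding.comp
    IsEmbedding.subtypeVal

end

@[fun_prop]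
lemma continuous_mat : Continuous (mat : lowerTri p → _) := isEmbedding_mat.continuous

lemma continuous_toLower : Continuous (toLower p) :=
  (toLower p).continuous_of_finiteDimensional

lemma continuous_coords : Continuous (coords : lowerTri p → _) := by
  unfold coords
  have h : ∀ i j, Continuous fun s : lowerTri p => mat s i j :=
    fun i j => continuous_mat.matrix_elem i j
  exact (continuous_pi fun i => Complex.continuous_re.comp (h i i)).prodMk
    (continuous_pi fun ij => h _ _)

/-- The matrix is a continuous function of the coordinates and is itself an embedding; the range is
cut out by finitely many strict inequalities. Local compactness, second countability and
metrizability of `S` follow. -/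
lemma isOpenEmbedding_coords : IsOpenEmbedding (coords : lowerTri p → _) where
  toIsInducing := IsInducing.of_comp continuous_coords continuous_toLower (by
    have : toLower p ∘ coords = mat := funext toLower_coords
    rw [this]
    exact isEmbedding_mat.toIsInducing)
  injective s t h := mat_injective (by rw [← toLower_coords, h, toLower_coords])
  isOpen_range := by
    rw [range_coords]
    simp only [Set.ofPred_forall]
    exact isOpen_iInter_of_finite fun i =>
      isOpen_lt continuous_const ((continuous_apply i).comp continuous_fst)

instance : LocallyCompactSpace (lowerTri p) := isOpenEmbedding_coords.locallyCompactSpace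
instance : SecondCountableTopology (lowerTri p) :=
  isOpenEmbedding_coords.isInducing.secondCountableTopology
instance : TopologicalSpace.MetrizableSpace (lowerTri p) :=
  isOpenEmbedding_coords.isEmbedding.metrizableSpace

end Coordinates

/-! ### `N` and `P` as second countable locally compact groups. -/

section Topology

open Topology

variable {p m : ℕ}

instance : LocallyCompactSpace (Matrix (Fin p) (Fin m) ℂ) :=
  inferInstanceAs (LocallyCompactSpace (Fin p → Fin m → ℂ))
instance : SecondCountableTopology (Matrix (Fin p) (Fin m) ℂ) :=
  inferInstanceAs (SecondCountableTopology (Fin p → Fin m → ℂ))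
instance : TopologicalSpace.MetrizableSpace (Matrix (Fin p) (Fin m) ℂ) :=
  inferInstanceAs (TopologicalSpace.MetrizableSpace (Fin p → Fin m → ℂ))

instance : LocallyCompactSpace (skewAdjoint (Matrix (Fin p) (Fin p) ℂ)) := by
  refine IsClosedEmbedding.locallyCompactSpace (f := Subtype.val)
    (IsClosed.isClosedEmbedding_subtypeVal ?_)
  exact isClosed_eq (f := star) (g := fun x => -x) continuous_star continuous_neg

instance : SecondCountableTopology (skewAdjoint (Matrix (Fin p) (Fin p) ℂ)) :=
  IsInducing.subtypeVal.secondCountableTopology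
instance : TopologicalSpace.MetrizableSpace (skewAdjoint (Matrix (Fin p) (Fin p) ℂ)) :=
  IsEmbedding.subtypeVal.metrizableSpace

namespace Heis

/-- The coordinates `(n, z)` on `N`, as a homeomorphism. -/
def homeomorphProd : Heis p m ≃ₜ
    skewAdjoint (Matrix (Fin p) (Fin p) ℂ) × Matrix (Fin p) (Fin m) ℂ where
  toFun g := (g.n, g.z)
  invFun x := ⟨x.1, x.2⟩
  left_inv _ := rfl
  right_inv _ := rfl
  continuous_toFun := continuous_induced_dom
  continuous_invFun := continuous_induced_rng.2 continuous_id

instance : LocallyCompactSpace (Heis p m) :=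
  homeomorphProd.isOpenEmbedding.locallyCompactSpace
instance : SecondCountableTopology (Heis p m) :=
  homeomorphProd.isInducing.secondCountableTopology
instance : TopologicalSpace.MetrizableSpace (Heis p m) :=
  homeomorphProd.isEmbedding.metrizableSpace

lemma continuous_n : Continuous fun g : Heis p m => (g.n : Matrix (Fin p) (Fin p) ℂ) :=
  continuous_subtype_val.comp (continuous_fst.comp homeomorphProd.continuous)

lemma continuous_z : Continuous fun g : Heis p m => g.z :=
  continuous_snd.comp homeomorphProd.continuous

lemma continuous_iff {X : Type*} [TopologicalSpace X] {f : X → Heis p m} :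
    Continuous f ↔ Continuous (fun x => ((f x).n : Matrix (Fin p) (Fin p) ℂ)) ∧
      Continuous fun x => (f x).z := by
  rw [← homeomorphProd.comp_continuous_iff, continuous_prodMk,
    IsInducing.subtypeVal.continuous_iff]
  rfl

instance : IsTopologicalGroup (Heis p m) where
  continuous_mul := by
    refine continuous_iff.2 ⟨?_, ?_⟩
    · simp only [mul_n, form, AddSubgroup.coe_add, AddSubgroup.coe_sub]
      have h1 := continuous_n (p := p) (m := m)
      have h2 := continuous_z (p := p) (m := m)
      have a1 := h2.comp (continuous_fst (Y := Heis p m))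
      have a2 := h2.comp (continuous_snd (X := Heis p m))
      refine ((h1.comp continuous_fst).add (h1.comp continuous_snd)).sub
        (Continuous.const_smul ?_ (1 / 2 : ℂ))
      exact (a1.matrix_mul a2.matrix_conjTranspose).sub (a2.matrix_mul a1.matrix_conjTranspose)
    · exact (continuous_z.comp continuous_fst).add (continuous_z.comp continuous_snd)
  continuous_inv := continuous_iff.2 ⟨continuous_n.neg, continuous_z.neg⟩

lemma act_apply (s : lowerTri p) (g : Heis p m) : act p m s g = conj s g := rfl

lemma continuous_conj {X : Type*} [TopologicalSpace X] {f : X → lowerTri p} {g : X → Heis p m}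
    (hf : Continuous f) (hg : Continuous g) : Continuous fun x => conj (f x) (g x) := by
  have h := continuous_mat.comp hf
  exact continuous_iff.2 ⟨(h.matrix_mul (continuous_n.comp hg)).matrix_mul
    h.matrix_conjTranspose, h.matrix_mul (continuous_z.comp hg)⟩

end Heis

namespace IwasawaGroup

/-- The decomposition `P = N × S`, as a homeomorphism. -/
def homeomorphProd : IwasawaGroup p m ≃ₜ Heis p m × lowerTri p where
  toFun g := (g.left, g.right)
  invFun x := ⟨x.1, x.2⟩
  left_inv _ := rfl
  right_inv _ := rfl
  continuous_toFun := continuous_induced_dom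
  continuous_invFun := continuous_induced_rng.2 continuous_id

lemma continuous_left : Continuous fun g : IwasawaGroup p m => g.left :=
  continuous_fst.comp homeomorphProd.continuous

lemma continuous_right : Continuous fun g : IwasawaGroup p m => g.right :=
  continuous_snd.comp homeomorphProd.continuous

instance : LocallyCompactSpace (IwasawaGroup p m) :=
  homeomorphProd.isOpenEmbedding.locallyCompactSpace
instance : SecondCountableTopology (IwasawaGroup p m) :=
  homeomorphProd.isInducing.secondCountableTopology

lemma continuous_iff {X : Type*} [TopologicalSpace X] {f : X → IwasawaGroup p m} :
    Continuous f ↔ Continuous (fun x => (f x).left) ∧ Continuous fun x => (f x).right := by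
  rw [← homeomorphProd.comp_continuous_iff, ← continuous_prodMk]
  rfl

instance : IsTopologicalGroup (IwasawaGroup p m) where
  continuous_mul := by
    have l1 : Continuous fun x : IwasawaGroup p m × IwasawaGroup p m => x.1.left :=
      continuous_left.comp continuous_fst
    have l2 : Continuous fun x : IwasawaGroup p m × IwasawaGroup p m => x.2.left :=
      continuous_left.comp continuous_snd
    have r1 : Continuous fun x : IwasawaGroup p m × IwasawaGroup p m => x.1.right :=
      continuous_right.comp continuous_fst
    have r2 : Continuous fun x : IwasawaGroup p m × IwasawaGroup p m => x.2.right :=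
      continuous_right.comp continuous_snd
    have h : Continuous fun x : IwasawaGroup p m × IwasawaGroup p m =>
        Heis.conj x.1.right x.2.left := Heis.continuous_conj r1 l2
    refine continuous_iff.2 ⟨?_, ?_⟩
    · simp only [SemidirectProduct.mul_left, Heis.act_apply]
      exact l1.mul h
    · simp only [SemidirectProduct.mul_right]
      exact r1.mul r2
  continuous_inv := by
    have l : Continuous fun x : IwasawaGroup p m => x.left⁻¹ := continuous_left.inv
    have r : Continuous fun x : IwasawaGroup p m => x.right⁻¹ := continuous_right.inv
    have h : Continuous fun x : IwasawaGroup p m => Heis.conj x.right⁻¹ x.left⁻¹ :=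
      Heis.continuous_conj r l
    refine continuous_iff.2 ⟨?_, ?_⟩
    · simp only [SemidirectProduct.inv_left, Heis.act_apply]
      exact h
    · simp only [SemidirectProduct.inv_right]
      exact r

end IwasawaGroup

noncomputable instance : MeasurableSpace (Heis p m) := borel _
instance : BorelSpace (Heis p m) := ⟨rfl⟩
noncomputable instance : MeasurableSpace (IwasawaGroup p m) := borel _
instance : BorelSpace (IwasawaGroup p m) := ⟨rfl⟩

end Topology

/-! ### L² norms as lower integrals. -/

section LpTwo

variable {α E : Type*} [MeasurableSpace α] {μ : Measure α} [NormedAddCommGroup E]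

lemma eLpNorm_two_sq (f : α → E) : eLpNorm f 2 μ ^ 2 = ∫⁻ x, ‖f x‖ₑ ^ 2 ∂μ := by
  have h := eLpNorm_nnreal_pow_eq_lintegral (μ := μ) (f := f) (p := 2) two_ne_zero
  simpa only [ENNReal.coe_ofNat, NNReal.coe_ofNat, ENNReal.rpow_ofNat] using h

lemma eLpNorm_two_lt_top_iff (f : α → E) : eLpNorm f 2 μ < ∞ ↔ ∫⁻ x, ‖f x‖ₑ ^ 2 ∂μ < ∞ := by
  rw [← eLpNorm_two_sq, ENNReal.pow_lt_top_iff]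
  simp

lemma enorm_sq_eq_lintegral (f : Lp E 2 μ) : ‖f‖ₑ ^ 2 = ∫⁻ x, ‖f x‖ₑ ^ 2 ∂μ := by
  rw [Lp.enorm_def, eLpNorm_two_sq]

lemma enorm_sub_sq_eq_lintegral (f g : Lp E 2 μ) :
    ‖f - g‖ₑ ^ 2 = ∫⁻ x, ‖f x - g x‖ₑ ^ 2 ∂μ := by
  rw [enorm_sq_eq_lintegral]
  refine lintegral_congr_ae ?_
  filter_upwards [Lp.coeFn_sub f g] with x hx
  rw [hx, Pi.sub_apply]

lemma measurable_norm_of_enorm_sq {G : Type*} [MeasurableSpace G] {F : G → E}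
    (h : Measurable fun g => ‖F g‖ₑ ^ 2) : Measurable fun g => ‖F g‖ := by
  have h' : (fun g => ‖F g‖) = fun g => Real.sqrt (‖F g‖ₑ ^ 2).toReal := by
    funext g
    rw [ENNReal.toReal_pow, toReal_enorm, Real.sqrt_sq (norm_nonneg _)]
  rw [h']
  exact Real.continuous_sqrt.measurable.comp h.ennreal_toReal

end LpTwo

/-! ### The unitary operators of `N` in L² of the Gaussian measure. -/

section Gauss

variable {p m : ℕ}

lemma trace_mul_conjTranspose (z w : Matrix (Fin p) (Fin m) ℂ) :
    (z * wᴴ).trace = ∑ i, ∑ j, z i j * star (w i j) := by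
  simp [Matrix.trace, Matrix.mul_apply]

lemma trace_skewAdjoint_re (n : skewAdjoint (Matrix (Fin p) (Fin p) ℂ)) :
    (n : Matrix (Fin p) (Fin p) ℂ).trace.re = 0 := by
  have h := congrArg Matrix.trace (skewAdjoint.mem_iff.1 n.2)
  rw [Matrix.star_eq_conjTranspose, Matrix.trace_conjTranspose, Matrix.trace_neg] at h
  have h' := congrArg Complex.re h
  simp only [Complex.star_def, Complex.conj_re, Complex.neg_re] at h'
  linarith

/-- The component `z` of an element of `N`, as a vector of `Z`. -/
def Heis.vec (g : Heis p m) : ZSpace p m := g.z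

lemma Heis.continuous_vec : Continuous fun g : Heis p m => g.vec := Heis.continuous_z

lemma Heis.vec_one : (1 : Heis p m).vec = 0 := rfl

lemma Heis.vec_mul (g h : Heis p m) : (g * h).vec = g.vec + h.vec := rfl

/-- The multiplier in the formula for the operator of `g`. -/
noncomputable def heisMul (g : Heis p m) (z : ZSpace p m) : ℂ :=
  Complex.exp (Matrix.trace
    ((g.n : Matrix (Fin p) (Fin p) ℂ) - (1 / 2 : ℂ) • (g.z * g.zᴴ) - Matrix.of z * g.zᴴ))

lemma heisOp_apply (g : Heis p m) (φ : ZSpace p m → ℂ) (z : ZSpace p m) :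
    heisOp g φ z = heisMul g z * φ (z + g.vec) := rfl

lemma heisMul_eq (g : Heis p m) (z : ZSpace p m) :
    heisMul g z = Complex.exp (Matrix.trace
      ((g.n : Matrix (Fin p) (Fin p) ℂ) - (1 / 2 : ℂ) • (g.z * g.zᴴ))) *
        Complex.exp (-∑ i, ∑ j, z i j * star (g.z i j)) := by
  rw [heisMul, Matrix.trace_sub, trace_mul_conjTranspose, sub_eq_add_neg, Complex.exp_add]
  rfl

lemma continuous_heisMul : Continuous fun x : Heis p m × ZSpace p m => heisMul x.1 x.2 := by
  unfold heisMul
  have hn := Heis.continuous_n.comp (continuous_fst (X := Heis p m) (Y := ZSpace p m))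
  have hz := Heis.continuous_z.comp (continuous_fst (X := Heis p m) (Y := ZSpace p m))
  have hw : Continuous fun x : Heis p m × ZSpace p m => Matrix.of x.2 := continuous_snd
  refine Complex.continuous_exp.comp (Continuous.matrix_trace ?_)
  exact (hn.sub ((hz.matrix_mul hz.matrix_conjTranspose).const_smul (1 / 2 : ℂ))).sub
    (hw.matrix_mul hz.matrix_conjTranspose)

lemma differentiable_heisMul (g : Heis p m) : Differentiable ℂ (heisMul g) := by
  simp only [funext (heisMul_eq g)]
  fun_prop

/-- Completing the square: tr n is imaginary and contributes only a phase, and the remaining real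
parts assemble into −|z + z₀|². This is what makes the operators isometric. -/
lemma norm_heisMul_sq (g : Heis p m) (z : ZSpace p m) :
    ‖heisMul g z‖ ^ 2 * Real.exp (-∑ i, ∑ j, ‖z i j‖ ^ 2) =
      Real.exp (-∑ i, ∑ j, ‖z i j + g.z i j‖ ^ 2) := by
  rw [heisMul_eq, norm_mul, Complex.norm_exp, Complex.norm_exp, ← Real.exp_add, ← Real.exp_nat_mul,
    ← Real.exp_add, Matrix.trace_sub, Matrix.trace_smul, trace_mul_conjTranspose, Complex.sub_re,
    trace_skewAdjoint_re]
  congr 1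
  simp only [smul_eq_mul, Complex.neg_re, Finset.mul_sum, Complex.re_sum, zero_sub, mul_add,
    mul_neg, ← Finset.sum_neg_distrib, ← Finset.sum_add_distrib]
  refine Finset.sum_congr rfl fun i _ => Finset.sum_congr rfl fun j _ => ?_
  simp only [← Complex.normSq_eq_norm_sq, Complex.normSq_apply, Complex.add_re, Complex.add_im,
    Complex.mul_re, Complex.mul_im, Complex.star_def, Complex.conj_re, Complex.conj_im]
  norm_num
  ring

/-- The density of the Gaussian measure. -/
noncomputable def gaussDensity (p m : ℕ) (z : ZSpace p m) : ℝ≥0∞ :=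
  ENNReal.ofReal ((Real.pi ^ (p * m))⁻¹ * Real.exp (-∑ i, ∑ j, ‖z i j‖ ^ 2))

lemma measurable_gaussDensity : Measurable (gaussDensity p m) := by
  refine ENNReal.measurable_ofReal.comp (Continuous.measurable ?_)
  fun_prop

lemma gauss_eq : gauss p m = volume.withDensity (gaussDensity p m) := rfl

lemma gauss_absolutelyContinuous : gauss p m ≪ volume := withDensity_absolutelyContinuous _ _

lemma absolutelyContinuous_gauss : (volume : Measure (ZSpace p m)) ≪ gauss p m := by
  refine withDensity_absolutelyContinuous' measurable_gaussDensity.aemeasurable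
    (Filter.Eventually.of_forall fun z => ?_)
  exact (ENNReal.ofReal_pos.2 (by positivity)).ne'

lemma lintegral_gauss (F : ZSpace p m → ℝ≥0∞) :
    ∫⁻ z, F z ∂(gauss p m) = ∫⁻ z, gaussDensity p m z * F z :=
  lintegral_withDensity_eq_lintegral_mul_non_measurable _ measurable_gaussDensity
    (Filter.Eventually.of_forall fun _ => ENNReal.ofReal_lt_top) F

lemma enorm_heisMul_sq (g : Heis p m) (z : ZSpace p m) :
    gaussDensity p m z * ‖heisMul g z‖ₑ ^ 2 = gaussDensity p m (z + g.vec) := by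
  have h := norm_heisMul_sq g z
  rw [gaussDensity, gaussDensity, ← ofReal_norm, ← ENNReal.ofReal_pow (norm_nonneg _),
    ← ENNReal.ofReal_mul (by positivity), mul_assoc, mul_comm (Real.exp _), h]
  rfl

lemma lintegral_heisOp (g : Heis p m) (φ : ZSpace p m → ℂ) :
    ∫⁻ z, ‖heisOp g φ z‖ₑ ^ 2 ∂(gauss p m) = ∫⁻ z, ‖φ z‖ₑ ^ 2 ∂(gauss p m) := by
  rw [lintegral_gauss, lintegral_gauss,
    ← lintegral_add_right_eq_self (fun z => gaussDensity p m z * ‖φ z‖ₑ ^ 2) g.vec]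
  refine lintegral_congr fun z => ?_
  rw [heisOp_apply, enorm_mul, mul_pow, ← mul_assoc, enorm_heisMul_sq]

lemma quasiMeasurePreserving_add_gauss (w : ZSpace p m) :
    Measure.QuasiMeasurePreserving (fun z => z + w) (gauss p m) (gauss p m) where
  measurable := measurable_add_const w
  absolutelyContinuous :=
    (gauss_absolutelyContinuous.map (measurable_add_const w)).trans (by
      rw [map_add_right_eq_self]
      exact absolutelyContinuous_gauss)

lemma heisOp_congr (g : Heis p m) {φ ψ : ZSpace p m → ℂ} (h : φ =ᵐ[gauss p m] ψ) :
    heisOp g φ =ᵐ[gauss p m] heisOp g ψ := by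
  filter_upwards [(quasiMeasurePreserving_add_gauss g.vec).ae h] with z hz
  rw [heisOp_apply, heisOp_apply, hz]

lemma heisOp_one (φ : ZSpace p m → ℂ) : heisOp 1 φ = φ := by
  funext z
  simp [heisOp_apply, heisMul, Heis.one_n, Heis.one_z, Heis.vec_one]

/-- The multiplier of h is evaluated at the shifted point, producing the extra term −z₁z₂*. It is
matched by the cross terms of −½(z₁ + z₂)(z₁ + z₂)* together with the form in the group law. -/
lemma heisOp_mul (g h : Heis p m) (φ : ZSpace p m → ℂ) :
    heisOp (g * h) φ = heisOp g (heisOp h φ) := by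
  funext z
  rw [heisOp_apply, heisOp_apply, heisOp_apply, ← mul_assoc, Heis.vec_mul, add_assoc]
  congr 1
  rw [heisMul, heisMul, heisMul, ← Complex.exp_add, ← Matrix.trace_add]
  congr 2
  have : Matrix.of (z + g.vec) = Matrix.of z + g.z := rfl
  rw [this]
  simp only [Heis.mul_n, Heis.mul_z, Heis.form, AddSubgroup.coe_add, AddSubgroup.coe_sub,
    Matrix.conjTranspose_add, Matrix.add_mul, Matrix.mul_add]
  module

lemma heisOp_add (g : Heis p m) (φ ψ : ZSpace p m → ℂ) :
    heisOp g (φ + ψ) = heisOp g φ + heisOp g ψ := by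
  funext z
  simp [heisOp_apply, mul_add]

lemma heisOp_smul (g : Heis p m) (c : ℂ) (φ : ZSpace p m → ℂ) :
    heisOp g (c • φ) = c • heisOp g φ := by
  funext z
  simp [heisOp_apply, mul_left_comm]

lemma aestronglyMeasurable_heisOp (g : Heis p m) {φ : ZSpace p m → ℂ}
    (h : AEStronglyMeasurable φ (gauss p m)) : AEStronglyMeasurable (heisOp g φ) (gauss p m) :=
  (differentiable_heisMul g).continuous.aestronglyMeasurable.mul
    (h.comp_quasiMeasurePreserving (quasiMeasurePreserving_add_gauss g.vec))

lemma memLp_heisOp (g : Heis p m) (φ : Lp ℂ 2 (gauss p m)) :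
    MemLp (heisOp g φ) 2 (gauss p m) := by
  refine ⟨aestronglyMeasurable_heisOp g (Lp.aestronglyMeasurable φ), ?_⟩
  rw [eLpNorm_two_lt_top_iff, lintegral_heisOp, ← eLpNorm_two_lt_top_iff]
  exact Lp.eLpNorm_lt_top φ

/-- The operator of `g ∈ N` in the whole of `L²(Z, gauss)`. -/
noncomputable def heisL2 (g : Heis p m) : Lp ℂ 2 (gauss p m) →ₗᵢ[ℂ] Lp ℂ 2 (gauss p m) where
  toFun φ := (memLp_heisOp g φ).toLp
  map_add' φ ψ := by
    refine Lp.ext ((MemLp.coeFn_toLp _).trans ((heisOp_congr g (Lp.coeFn_add φ ψ)).trans ?_))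
    rw [heisOp_add]
    exact ((MemLp.coeFn_toLp _).symm.add (MemLp.coeFn_toLp _).symm).trans (Lp.coeFn_add _ _).symm
  map_smul' c φ := by
    refine Lp.ext ((MemLp.coeFn_toLp _).trans ((heisOp_congr g (Lp.coeFn_smul c φ)).trans ?_))
    rw [heisOp_smul]
    exact ((MemLp.coeFn_toLp _).symm.const_smul c).trans (Lp.coeFn_smul _ _).symm
  norm_map' φ := by
    have h : ‖(memLp_heisOp g φ).toLp‖ₑ ^ 2 = ‖φ‖ₑ ^ 2 := by
      rw [enorm_sq_eq_lintegral, enorm_sq_eq_lintegral, ← lintegral_heisOp g φ]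
      refine lintegral_congr_ae ?_
      filter_upwards [(memLp_heisOp g φ).coeFn_toLp] with z hz
      rw [hz]
    have h' := congrArg ENNReal.toReal h
    rw [ENNReal.toReal_pow, ENNReal.toReal_pow, toReal_enorm, toReal_enorm] at h'
    exact (pow_left_inj₀ (norm_nonneg _) (norm_nonneg _) two_ne_zero).1 h'

lemma heisL2_ae (g : Heis p m) (φ : Lp ℂ 2 (gauss p m)) :
    heisL2 g φ =ᵐ[gauss p m] heisOp g φ := (memLp_heisOp g φ).coeFn_toLp

lemma heisL2_one (φ : Lp ℂ 2 (gauss p m)) : heisL2 1 φ = φ := by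
  refine Lp.ext ((heisL2_ae 1 φ).trans ?_)
  rw [heisOp_one]

lemma heisL2_mul (g h : Heis p m) (φ : Lp ℂ 2 (gauss p m)) :
    heisL2 (g * h) φ = heisL2 g (heisL2 h φ) := by
  refine Lp.ext ((heisL2_ae (g * h) φ).trans ?_)
  rw [heisOp_mul]
  exact (heisOp_congr g (heisL2_ae h φ)).symm.trans (heisL2_ae g _).symm

instance : SFinite (gauss p m) := by rw [gauss_eq]; infer_instance

instance : Fact ((2 : ℝ≥0∞) ≠ ∞) := ⟨ENNReal.ofNat_ne_top⟩

/-- By automatic continuity only measurability of the distances is needed, and Tonelli supplies it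
from joint measurability in (g, z). -/
lemma continuous_heisL2_left (φ : Lp ℂ 2 (gauss p m)) : Continuous fun g => heisL2 g φ := by
  refine continuous_apply_of_measurable (fun g => heisL2 g) heisL2_one heisL2_mul
    (fun g => map_sub (heisL2 g)) (fun g => ⟨1, fun v => by simp⟩) (fun φ w => ?_) φ
  refine measurable_norm_of_enorm_sq ?_
  have h : ∀ g, ‖heisL2 g φ - w‖ₑ ^ 2 =
      ∫⁻ z, ‖heisMul g z * φ (z + g.vec) - w z‖ₑ ^ 2 ∂(gauss p m) := fun g => by
    rw [enorm_sub_sq_eq_lintegral]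
    refine lintegral_congr_ae ?_
    filter_upwards [heisL2_ae g φ] with z hz
    rw [hz]
    rfl
  simp only [h]
  refine Measurable.lintegral_prod_right' (f := fun x : Heis p m × ZSpace p m =>
    ‖heisMul x.1 x.2 * φ (x.2 + x.1.vec) - w x.2‖ₑ ^ 2) ?_
  have h1 : Measurable fun x : Heis p m × ZSpace p m => heisMul x.1 x.2 :=
    continuous_heisMul.measurable
  have h2 : Measurable fun x : Heis p m × ZSpace p m => x.2 + x.1.vec :=
    (continuous_snd.add (Heis.continuous_vec.comp continuous_fst)).measurable
  have h3 : Measurable fun x : Heis p m × ZSpace p m => φ (x.2 + x.1.vec) :=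
    (Lp.stronglyMeasurable φ).measurable.comp h2
  have h4 : Measurable fun x : Heis p m × ZSpace p m => w x.2 :=
    (Lp.stronglyMeasurable w).measurable.comp measurable_snd
  exact ((h1.mul h3).sub h4).enorm.pow_const 2

end Gauss

/-! ### Gaussian integrals of exponentials of linear forms. -/

section GaussIntegral

variable {p m : ℕ}

/-- The integral splits into two real Gaussian integrals with linear terms −w and −iw. Completing
the squares yields factors exp(w²/4) and exp(−w²/4), which cancel: an instance of the mean value
property. -/
lemma integral_complex_gaussian (w : ℂ) :
    ∫ z : ℂ, Complex.exp (-(‖z‖ ^ 2 : ℝ) - z * w) = Real.pi := by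
  rw [← (Complex.volume_preserving_equiv_real_prod.symm).integral_comp
    Complex.measurableEquivRealProd.symm.measurableEmbedding]
  have h : ∀ x : ℝ × ℝ, Complex.exp (-(‖Complex.measurableEquivRealProd.symm x‖ ^ 2 : ℝ) -
      Complex.measurableEquivRealProd.symm x * w) =
      Complex.exp (-1 * (x.1 : ℂ) ^ 2 + (-w) * x.1 + 0) *
        Complex.exp (-1 * (x.2 : ℂ) ^ 2 + (-Complex.I * w) * x.2 + 0) := fun x => by
    rw [← Complex.exp_add, Complex.measurableEquivRealProd_symm_apply,
      ← Complex.normSq_eq_norm_sq, Complex.normSq_mk]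
    congr 1
    have : (⟨x.1, x.2⟩ : ℂ) = x.1 + x.2 * Complex.I := by
      apply Complex.ext <;> simp
    rw [this]
    push_cast
    ring
  simp only [h]
  have hpi : (Real.pi : ℂ) ≠ 0 := by exact_mod_cast Real.pi_ne_zero
  rw [Measure.volume_eq_prod, integral_prod_mul
      (fun x : ℝ => Complex.exp (-1 * (x : ℂ) ^ 2 + (-w) * x + 0)) (fun x : ℝ =>
      Complex.exp (-1 * (x : ℂ) ^ 2 + (-Complex.I * w) * x + 0)),
    integral_cexp_quadratic (by simp), integral_cexp_quadratic (by simp)]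
  rw [neg_neg, div_one, mul_mul_mul_comm, ← Complex.exp_add, ← Complex.cpow_add _ _ hpi]
  rw [show (0 - (-w) ^ 2 / (4 * -1) + (0 - (-Complex.I * w) ^ 2 / (4 * -1)) : ℂ) = 0 by
    rw [mul_pow, neg_sq Complex.I, Complex.I_sq]; ring]
  norm_num

lemma integral_gauss (w : Fin p → Fin m → ℂ) :
    ∫ z, Complex.exp (-∑ i, ∑ j, z i j * w i j) ∂(gauss p m) = 1 := by
  have hg : gauss p m = volume.withDensity fun z =>
      ((Real.toNNReal ((Real.pi ^ (p * m))⁻¹ * Real.exp (-∑ i, ∑ j, ‖z i j‖ ^ 2)) : ℝ≥0) : ℝ≥0∞) :=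
    rfl
  rw [hg, integral_withDensity_eq_integral_smul]
  swap
  · refine measurable_real_toNNReal.comp (Continuous.measurable ?_)
    fun_prop
  have h : ∀ z : ZSpace p m, (Real.toNNReal ((Real.pi ^ (p * m))⁻¹ *
      Real.exp (-∑ i, ∑ j, ‖z i j‖ ^ 2))) • Complex.exp (-∑ i, ∑ j, z i j * w i j) =
      ((Real.pi : ℂ) ^ (p * m))⁻¹ *
        ∏ i, ∏ j, Complex.exp (-(‖z i j‖ ^ 2 : ℝ) - z i j * w i j) := fun z => by
    rw [NNReal.smul_def, Real.coe_toNNReal _ (by positivity), Complex.real_smul]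
    simp only [← Complex.exp_sum, Finset.sum_sub_distrib]
    rw [sub_eq_add_neg, Complex.exp_add, ← mul_assoc]
    push_cast
    simp only [Finset.sum_neg_distrib]
  simp only [h]
  rw [integral_const_mul, integral_fintype_prod_volume_eq_prod (fun i (y : Fin m → ℂ) =>
    ∏ j, Complex.exp (-(‖y j‖ ^ 2 : ℝ) - y j * w i j))]
  have h1 : ∀ i, ∫ y : Fin m → ℂ, ∏ j, Complex.exp (-(‖y j‖ ^ 2 : ℝ) - y j * w i j) =
      (Real.pi : ℂ) ^ m := fun i => by
    rw [integral_fintype_prod_volume_eq_prod (fun j (y : ℂ) =>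
      Complex.exp (-(‖y‖ ^ 2 : ℝ) - y * w i j))]
    simp only [integral_complex_gaussian]
    simp
  simp only [h1]
  have hpi : (Real.pi : ℂ) ≠ 0 := by exact_mod_cast Real.pi_ne_zero
  rw [Finset.prod_const, Finset.card_univ, Fintype.card_fin, ← pow_mul, mul_comm m p]
  exact inv_mul_cancel₀ (pow_ne_zero _ hpi)

instance : IsProbabilityMeasure (gauss p m) where
  measure_univ := by
    have h := integral_gauss (p := p) (m := m) 0
    simp only [Pi.zero_apply, mul_zero, Finset.sum_const_zero, neg_zero, Complex.exp_zero,
      integral_const, Complex.real_smul, mul_one] at h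
    have h' : (gauss p m).real Set.univ = 1 := by exact_mod_cast h
    rw [measureReal_def] at h'
    exact (ENNReal.toReal_eq_one_iff _).1 h'

end GaussIntegral

/-! ### The Bargmann space, its vacuum vector and the vacuum coefficient. -/

section Bargmann

variable {p m : ℕ}

lemma heisL2_mem_bargmann (g : Heis p m) (φ : bargmann p m) :
    heisL2 g (φ : Lp ℂ 2 (gauss p m)) ∈ bargmann p m := by
  obtain ⟨F, hF, h⟩ := φ.2
  refine ⟨heisOp g F, ?_, (heisL2_ae g _).trans (heisOp_congr g h)⟩
  exact (differentiable_heisMul g).mul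
    (hF.comp (differentiable_id.add (differentiable_const g.vec)))

/-- The operator of `g ∈ N` in the Bargmann space. -/
noncomputable def heisK (g : Heis p m) : bargmann p m →ₗᵢ[ℂ] bargmann p m where
  toLinearMap := ((heisL2 g).toLinearMap.comp (bargmann p m).subtype).codRestrict (bargmann p m)
    (heisL2_mem_bargmann g)
  norm_map' φ := (heisL2 g).norm_map φ

lemma bargmannFun_heisK (g : Heis p m) (φ : bargmann p m) :
    bargmannFun (heisK g φ) =ᵐ[gauss p m] heisOp g (bargmannFun φ) := heisL2_ae g φ

lemma bargmann_ext {φ ψ : bargmann p m} (h : bargmannFun φ =ᵐ[gauss p m] bargmannFun ψ) :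
    φ = ψ := Subtype.ext (Lp.ext h)

lemma heisK_one (φ : bargmann p m) : heisK 1 φ = φ :=
  Subtype.ext (heisL2_one _)

lemma heisK_mul (g h : Heis p m) (φ : bargmann p m) : heisK (g * h) φ = heisK g (heisK h φ) :=
  Subtype.ext (heisL2_mul g h _)

/-- For isometries strong continuity upgrades to joint continuity, which is needed below when g and
the vector both vary with s. -/
lemma continuous_heisK : Continuous fun x : Heis p m × bargmann p m => heisK x.1 x.2 := by
  refine continuous_iff_continuousAt.2 fun x => ?_
  rw [ContinuousAt, tendsto_iff_norm_sub_tendsto_zero]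
  have h1 : Continuous fun y : Heis p m × bargmann p m =>
      ‖y.2 - x.2‖ + ‖heisK y.1 x.2 - heisK x.1 x.2‖ := by
    refine (continuous_snd.sub continuous_const).norm.add (Continuous.norm ?_)
    refine Continuous.sub (Continuous.subtype_mk ?_ _) continuous_const
    exact (continuous_heisL2_left (x.2 : Lp ℂ 2 (gauss p m))).comp continuous_fst
  have h2 := h1.tendsto x
  simp only [sub_self, norm_zero, add_zero] at h2
  refine squeeze_zero (fun _ => norm_nonneg _) (fun y => ?_) h2
  calc ‖heisK y.1 y.2 - heisK x.1 x.2‖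
      = ‖heisK y.1 (y.2 - x.2) + (heisK y.1 x.2 - heisK x.1 x.2)‖ := by
        rw [map_sub]; congr 1; abel
    _ ≤ ‖heisK y.1 (y.2 - x.2)‖ + ‖heisK y.1 x.2 - heisK x.1 x.2‖ := norm_add_le _ _
    _ = _ := by rw [LinearIsometry.norm_map]

/-- The constant function `1` in the Bargmann space. -/
noncomputable def bargmannOne (p m : ℕ) : bargmann p m :=
  ⟨Lp.const 2 (gauss p m) (1 : ℂ), fun _ => 1, differentiable_const 1, Lp.coeFn_const ..⟩

lemma bargmannFun_one : bargmannFun (bargmannOne p m) =ᵐ[gauss p m] fun _ => 1 :=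
  Lp.coeFn_const ..

lemma bargmannFun_smul (c : ℂ) (φ : bargmann p m) :
    bargmannFun (c • φ) =ᵐ[gauss p m] fun z => c * bargmannFun φ z :=
  Lp.coeFn_smul c (φ : Lp ℂ 2 (gauss p m))

lemma bargmannFun_sub (φ ψ : bargmann p m) :
    bargmannFun (φ - ψ) =ᵐ[gauss p m] fun z => bargmannFun φ z - bargmannFun ψ z :=
  Lp.coeFn_sub (φ : Lp ℂ 2 (gauss p m)) ψ

lemma norm_bargmannOne : ‖bargmannOne p m‖ = 1 := by
  change ‖Lp.const 2 (gauss p m) (1 : ℂ)‖ = 1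
  rw [Lp.norm_const _ _ _ two_ne_zero]
  simp

/-- The logarithm of the matrix coefficient of `1`. -/
noncomputable def heisExponent (g : Heis p m) : ℂ :=
  Matrix.trace ((g.n : Matrix (Fin p) (Fin p) ℂ) - (1 / 2 : ℂ) • (g.z * g.zᴴ))

/-- The image of 1 is a constant times the exponential of a linear form in z, and that exponential
has Gaussian mean 1. -/
lemma inner_heisK_one (g : Heis p m) :
    inner ℂ (bargmannOne p m) (heisK g (bargmannOne p m)) = Complex.exp (heisExponent g) := by
  change inner ℂ (Lp.const 2 (gauss p m) (1 : ℂ)) (heisL2 g (bargmannOne p m)) = _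
  rw [L2.inner_def]
  have h : (fun z => inner ℂ ((Lp.const 2 (gauss p m) (1 : ℂ)) z)
      ((heisL2 g (bargmannOne p m)) z)) =ᵐ[gauss p m] fun z => Complex.exp (heisExponent g) *
        Complex.exp (-∑ i, ∑ j, z i j * star (g.z i j)) := by
    filter_upwards [Lp.coeFn_const 2 (gauss p m) (1 : ℂ), heisL2_ae g (bargmannOne p m),
      heisOp_congr g (bargmannFun_one (p := p) (m := m))] with z h1 h2 h3
    have h4 : (heisL2 g (bargmannOne p m)) z = heisMul g z * 1 := h2.trans h3
    rw [h1, h4, heisMul_eq]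
    simp [heisExponent]
  rw [integral_congr_ae h, integral_const_mul, integral_gauss fun i j => star (g.z i j), mul_one]

/-- Expanding the square for an isometry and a unit vector; this is the source of the integrand in
condition (iii). -/
lemma norm_heisK_one_sub_sq (g : Heis p m) :
    ‖heisK g (bargmannOne p m) - bargmannOne p m‖ ^ 2 =
      2 * (1 - (Complex.exp (heisExponent g)).re) := by
  rw [@norm_sub_sq ℂ, LinearIsometry.norm_map, norm_bargmannOne, ← inner_conj_symm, inner_heisK_one]
  simp only [RCLike.re_to_complex, Complex.conj_re]
  ring

end Bargmann

/-! ### Translations under an almost invariant measure and the pointwise action of `P`. -/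

section Translation

variable {p m : ℕ} {ν : Measure (lowerTri p)}

lemma AlmostInvariant.quasiMeasurePreserving (hν : AlmostInvariant ν) (t : lowerTri p) :
    Measure.QuasiMeasurePreserving (fun s => s * t) ν ν where
  measurable := (continuous_mul_const t).measurable
  absolutelyContinuous := by simpa only [inv_inv] using (hν t⁻¹).1

/-- By absolute continuity the translated measure is its Radon–Nikodym derivative times ν, so a
bound on the derivative becomes a domination of measures. -/
lemma AlmostInvariant.exists_map_le [SigmaFinite ν] (hν : AlmostInvariant ν) (t : lowerTri p) :
    ∃ C : ℝ≥0, ν.map (fun s => s * t) ≤ C • ν := by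
  obtain ⟨h1, -, C, hC⟩ := hν t⁻¹
  simp only [inv_inv] at h1 hC
  refine ⟨C, ?_⟩
  rw [← Measure.withDensity_rnDeriv_eq _ _ h1]
  calc ν.withDensity _ ≤ ν.withDensity fun _ => (C : ℝ≥0∞) := withDensity_mono hC
    _ = C • ν := withDensity_const _

lemma AlmostInvariant.exists_lintegral_le [SigmaFinite ν] (hν : AlmostInvariant ν)
    (t : lowerTri p) : ∃ C : ℝ≥0, ∀ F : lowerTri p → ℝ≥0∞, AEMeasurable F ν →
      ∫⁻ s, F (s * t) ∂ν ≤ C * ∫⁻ s, F s ∂ν := by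
  obtain ⟨C, hC⟩ := hν.exists_map_le t
  refine ⟨C, fun F hF => ?_⟩
  have hq := hν.quasiMeasurePreserving t
  rw [← lintegral_map' (hF.mono_ac hq.absolutelyContinuous) hq.measurable.aemeasurable]
  refine (lintegral_mono' hC le_rfl).trans ?_
  rw [lintegral_smul_measure]
  rfl

/-- The action of `P` on functions on `S` with values in the Bargmann space. -/
noncomputable def transFun (x : IwasawaGroup p m) (Φ : lowerTri p → bargmann p m) :
    lowerTri p → bargmann p m :=
  fun s => heisK (Heis.conj s x.left) (Φ (s * x.right))

lemma transFun_one (Φ : lowerTri p → bargmann p m) : transFun 1 Φ = Φ := by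
  funext s
  have h : Heis.conj s (1 : Heis p m) = 1 := map_one (Heis.act p m s)
  simp [transFun, h, heisK_one]

/-- Translating s by the `S`-part of x changes conjugation by s into conjugation by the product,
which is the twist in the semidirect product law. -/
lemma transFun_mul (x y : IwasawaGroup p m) (Φ : lowerTri p → bargmann p m) :
    transFun (x * y) Φ = transFun x (transFun y Φ) := by
  funext s
  simp only [transFun]
  rw [SemidirectProduct.mul_left, SemidirectProduct.mul_right, Heis.act_apply,
    Heis.conj_mul_right, heisK_mul, ← Heis.conj_mul_left, mul_assoc]

lemma transFun_add (x : IwasawaGroup p m) (Φ Ψ : lowerTri p → bargmann p m) :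
    transFun x (Φ + Ψ) = transFun x Φ + transFun x Ψ := by
  funext s
  simp [transFun]

lemma transFun_sub (x : IwasawaGroup p m) (Φ Ψ : lowerTri p → bargmann p m) :
    transFun x (Φ - Ψ) = transFun x Φ - transFun x Ψ := by
  funext s
  simp [transFun]

lemma transFun_smul (x : IwasawaGroup p m) (c : ℂ) (Φ : lowerTri p → bargmann p m) :
    transFun x (c • Φ) = c • transFun x Φ := by
  funext s
  simp [transFun]

lemma transFun_congr (hν : AlmostInvariant ν) (x : IwasawaGroup p m)
    {Φ Ψ : lowerTri p → bargmann p m} (h : Φ =ᵐ[ν] Ψ) : transFun x Φ =ᵐ[ν] transFun x Ψ := by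
  filter_upwards [(hν.quasiMeasurePreserving x.right).ae h] with s hs
  rw [transFun, transFun, hs]

/-- Joint measurability in (x, s) is what Tonelli requires when the distances in L² are to be
measurable in x. -/
lemma stronglyMeasurable_transFun {Φ : lowerTri p → bargmann p m} (h : StronglyMeasurable Φ) :
    StronglyMeasurable fun y : IwasawaGroup p m × lowerTri p => transFun y.1 Φ y.2 := by
  have h1 : Continuous fun y : IwasawaGroup p m × lowerTri p => Heis.conj y.2 y.1.left :=
    Heis.continuous_conj continuous_snd (IwasawaGroup.continuous_left.comp continuous_fst)
  have h2 : Continuous fun y : IwasawaGroup p m × lowerTri p => y.2 * y.1.right :=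
    continuous_snd.mul (IwasawaGroup.continuous_right.comp continuous_fst)
  have h3 : StronglyMeasurable fun y : IwasawaGroup p m × lowerTri p =>
      Heis.conj y.2 y.1.left := h1.stronglyMeasurable
  have h4 : StronglyMeasurable fun y : IwasawaGroup p m × lowerTri p => Φ (y.2 * y.1.right) :=
    h.comp_measurable h2.measurable
  have h5 : StronglyMeasurable fun y : IwasawaGroup p m × lowerTri p =>
      (Heis.conj y.2 y.1.left, Φ (y.2 * y.1.right)) := h3.prodMk h4
  have h6 := continuous_heisK.comp_stronglyMeasurable h5
  simp only [transFun]
  exact h6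

lemma aestronglyMeasurable_transFun (hν : AlmostInvariant ν) (x : IwasawaGroup p m)
    {Φ : lowerTri p → bargmann p m} (h : AEStronglyMeasurable Φ ν) :
    AEStronglyMeasurable (transFun x Φ) ν := by
  obtain ⟨Ψ, hΨ, hΦ⟩ := h
  exact ((stronglyMeasurable_transFun hΨ).comp_measurable
    measurable_prodMk_left).aestronglyMeasurable.congr (transFun_congr hν x hΦ).symm

lemma enorm_transFun (x : IwasawaGroup p m) (Φ : lowerTri p → bargmann p m) (s : lowerTri p) :
    ‖transFun x Φ s‖ₑ = ‖Φ (s * x.right)‖ₑ := by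
  rw [transFun, ← ofReal_norm, LinearIsometry.norm_map, ofReal_norm]

lemma measurable_lintegral_transFun [SigmaFinite ν] {Φ Ψ : lowerTri p → bargmann p m}
    (hΦ : StronglyMeasurable Φ) (hΨ : StronglyMeasurable Ψ) :
    Measurable fun x : IwasawaGroup p m => ∫⁻ s, ‖transFun x Φ s - Ψ s‖ₑ ^ 2 ∂ν :=
  Measurable.lintegral_prod_right' (f := fun y : IwasawaGroup p m × lowerTri p =>
    ‖transFun y.1 Φ y.2 - Ψ y.2‖ₑ ^ 2)
    (((stronglyMeasurable_transFun hΦ).sub (hΨ.comp_measurable measurable_snd)).enorm.pow_const 2)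

end Translation

/-! ### The representation of `P` by bounded operators. -/

section Representation

variable {p m : ℕ} {ν : Measure (lowerTri p)} [SigmaFinite ν]

/-- The `N`-part acts isometrically in each fibre, so only the translation contributes to the norm.
-/
lemma exists_lintegral_transFun_le (hν : AlmostInvariant ν) (x : IwasawaGroup p m) :
    ∃ C : ℝ≥0, ∀ F : DirectIntegral m ν, ∫⁻ s, ‖transFun x F s‖ₑ ^ 2 ∂ν ≤ C * ‖F‖ₑ ^ 2 := by
  obtain ⟨C, hC⟩ := hν.exists_lintegral_le x.right
  refine ⟨C, fun F => ?_⟩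
  simp only [enorm_transFun, enorm_sq_eq_lintegral]
  exact hC (fun s => ‖F s‖ₑ ^ 2) ((Lp.aestronglyMeasurable F).enorm.pow_const 2)

lemma memLp_transFun (hν : AlmostInvariant ν) (x : IwasawaGroup p m) (F : DirectIntegral m ν) :
    MemLp (transFun x F) 2 ν := by
  refine ⟨aestronglyMeasurable_transFun hν x (Lp.aestronglyMeasurable F), ?_⟩
  obtain ⟨C, hC⟩ := exists_lintegral_transFun_le hν x
  rw [eLpNorm_two_lt_top_iff]
  exact (hC F).trans_lt (ENNReal.mul_lt_top ENNReal.coe_lt_top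
    (ENNReal.pow_lt_top enorm_lt_top))

/-- The linear operator of `x ∈ P` in `L²(S, ν; K)`. -/
noncomputable def transLM (hν : AlmostInvariant ν) (x : IwasawaGroup p m) :
    DirectIntegral m ν →ₗ[ℂ] DirectIntegral m ν where
  toFun F := (memLp_transFun hν x F).toLp
  map_add' F G := by
    refine Lp.ext ((MemLp.coeFn_toLp _).trans ((transFun_congr hν x (Lp.coeFn_add F G)).trans ?_))
    rw [transFun_add]
    exact ((MemLp.coeFn_toLp _).symm.add (MemLp.coeFn_toLp _).symm).trans (Lp.coeFn_add _ _).symm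
  map_smul' c F := by
    refine Lp.ext ((MemLp.coeFn_toLp _).trans ((transFun_congr hν x (Lp.coeFn_smul c F)).trans ?_))
    rw [transFun_smul]
    exact ((MemLp.coeFn_toLp _).symm.const_smul c).trans (Lp.coeFn_smul _ _).symm

lemma transLM_ae (hν : AlmostInvariant ν) (x : IwasawaGroup p m) (F : DirectIntegral m ν) :
    transLM hν x F =ᵐ[ν] transFun x F := (memLp_transFun hν x F).coeFn_toLp

lemma transLM_one (hν : AlmostInvariant ν) (F : DirectIntegral m ν) : transLM hν 1 F = F := by
  refine Lp.ext ((transLM_ae hν 1 F).trans ?_)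
  rw [transFun_one]

lemma transLM_mul (hν : AlmostInvariant ν) (x y : IwasawaGroup p m) (F : DirectIntegral m ν) :
    transLM hν (x * y) F = transLM hν x (transLM hν y F) := by
  refine Lp.ext ((transLM_ae hν (x * y) F).trans ?_)
  rw [transFun_mul]
  exact (transFun_congr hν x (transLM_ae hν y F)).symm.trans (transLM_ae hν x _).symm

lemma exists_norm_transLM_le (hν : AlmostInvariant ν) (x : IwasawaGroup p m) :
    ∃ C : ℝ, ∀ F : DirectIntegral m ν, ‖transLM hν x F‖ ≤ C * ‖F‖ := by
  obtain ⟨C, hC⟩ := exists_lintegral_transFun_le hν x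
  refine ⟨Real.sqrt C, fun F => ?_⟩
  have h : ‖transLM hν x F‖ₑ ^ 2 ≤ C * ‖F‖ₑ ^ 2 := by
    refine le_of_eq_of_le ?_ (hC F)
    rw [enorm_sq_eq_lintegral]
    refine lintegral_congr_ae ?_
    filter_upwards [transLM_ae hν x F] with s hs
    rw [hs]
  have h' := ENNReal.toReal_mono
    (ENNReal.mul_ne_top ENNReal.coe_ne_top (ENNReal.pow_ne_top enorm_ne_top)) h
  rw [ENNReal.toReal_mul, ENNReal.toReal_pow, ENNReal.toReal_pow, toReal_enorm, toReal_enorm,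
    ENNReal.coe_toReal] at h'
  refine abs_le_of_sq_le_sq' ?_ (by positivity) |>.2
  rwa [mul_pow, Real.sq_sqrt C.coe_nonneg]

/-- The bounded operator of `x ∈ P` in `L²(S, ν; K)`. -/
noncomputable def transCLM (hν : AlmostInvariant ν) (x : IwasawaGroup p m) :
    DirectIntegral m ν →L[ℂ] DirectIntegral m ν where
  toLinearMap := transLM hν x
  cont := by
    obtain ⟨C, hC⟩ := exists_norm_transLM_le hν x
    exact AddMonoidHomClass.continuous_of_bound (transLM hν x) C hC

/-- The representation of `P` in `L²(S, ν; K)`. -/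
noncomputable def iwasawaRep (hν : AlmostInvariant ν) :
    IwasawaGroup p m →* (DirectIntegral m ν →L[ℂ] DirectIntegral m ν) where
  toFun x := transCLM hν x
  map_one' := ContinuousLinearMap.ext fun F => transLM_one hν F
  map_mul' x y := ContinuousLinearMap.ext fun F => transLM_mul hν x y F

lemma iwasawaRep_ae (hν : AlmostInvariant ν) (x : IwasawaGroup p m) (F : DirectIntegral m ν) :
    iwasawaRep hν x F =ᵐ[ν] transFun x F := transLM_ae hν x F

lemma bargmannFun_transFun (x : IwasawaGroup p m) (Φ : lowerTri p → bargmann p m)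
    (s : lowerTri p) :
    bargmannFun (transFun x Φ s) =ᵐ[gauss p m] actFun x (fun t => bargmannFun (Φ t)) s :=
  bargmannFun_heisK _ _

theorem isAssociatedRep_iwasawaRep (hν : AlmostInvariant ν) :
    IsAssociatedRep ν (iwasawaRep (m := m) hν) := fun x F => by
  filter_upwards [iwasawaRep_ae hν x F] with s hs
  rw [hs]
  exact bargmannFun_transFun x F s

omit [SigmaFinite ν] in
theorem IsAssociatedRep.unique
    {T T' : IwasawaGroup p m →* (DirectIntegral m ν →L[ℂ] DirectIntegral m ν)}
    (hT : IsAssociatedRep ν T) (hT' : IsAssociatedRep ν T') : T = T' := by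
  refine MonoidHom.ext fun x => ContinuousLinearMap.ext fun F => Lp.ext ?_
  filter_upwards [hT x F, hT' x F] with s h h'
  have h'' : bargmannFun (T x F s) =ᵐ[gauss p m] bargmannFun (T' x F s) := by
    filter_upwards [h, h'] with z h1 h2
    rw [h1, h2]
  exact bargmann_ext h''

lemma measurable_norm_iwasawaRep_sub (hν : AlmostInvariant ν) (F W : DirectIntegral m ν) :
    Measurable fun x : IwasawaGroup p m => ‖iwasawaRep hν x F - W‖ := by
  refine measurable_norm_of_enorm_sq (G := IwasawaGroup p m) (E := DirectIntegral m ν) ?_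
  have h : ∀ x, ‖iwasawaRep hν x F - W‖ₑ ^ 2 = ∫⁻ s, ‖transFun x F s - W s‖ₑ ^ 2 ∂ν := fun x => by
    rw [enorm_sub_sq_eq_lintegral]
    refine lintegral_congr_ae ?_
    filter_upwards [iwasawaRep_ae hν x F] with s hs
    rw [hs]
  simp only [h]
  exact measurable_lintegral_transFun (Lp.stronglyMeasurable F) (Lp.stronglyMeasurable W)

theorem stronglyContinuous_iwasawaRep (hν : AlmostInvariant ν) :
    StronglyContinuous (G := IwasawaGroup p m) (H := DirectIntegral m ν) (iwasawaRep hν) := by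
  exact continuous_apply_of_measurable (G := IwasawaGroup p m) (H := DirectIntegral m ν)
    (fun x => transLM hν x) (transLM_one hν) (transLM_mul hν) (fun x => map_sub (transLM hν x))
    (exists_norm_transLM_le hν) (measurable_norm_iwasawaRep_sub hν)

end Representation

/-! ### The cocycle of f·1 and its nontriviality. -/

section Cocycle

variable {p m : ℕ} {ν : Measure (lowerTri p)} [SigmaFinite ν] {f : lowerTri p → ℝ}

/-- The function `s ↦ f(s) 1` with values in the Bargmann space. -/
noncomputable def vacuumFun (m : ℕ) (f : lowerTri p → ℝ) : lowerTri p → bargmann p m :=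
  fun s => (f s : ℂ) • bargmannOne p m

lemma enorm_vacuumFun_sq (f : lowerTri p → ℝ) (s : lowerTri p) :
    ‖vacuumFun m f s‖ₑ ^ 2 = ENNReal.ofReal (f s ^ 2) := by
  rw [← ofReal_norm, vacuumFun, norm_smul, norm_bargmannOne, mul_one, Complex.norm_real,
    ← ENNReal.ofReal_pow (norm_nonneg _), Real.norm_eq_abs, sq_abs]

lemma stronglyMeasurable_vacuumFun (hf : Measurable f) : StronglyMeasurable (vacuumFun m f) :=
  (Complex.measurable_ofReal.comp hf).stronglyMeasurable.smul_const _

lemma heisExponent_conj (s : lowerTri p) (g : Heis p m) :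
    heisExponent (Heis.conj s g) = Matrix.trace (mat s *
      ((g.n : Matrix (Fin p) (Fin p) ℂ) - (1 / 2 : ℂ) • (g.z * g.zᴴ)) * (mat s)ᴴ) := by
  simp [heisExponent, Heis.conj, Matrix.mul_sub, Matrix.sub_mul, Matrix.mul_assoc]

lemma heisExponent_re_nonpos (g : Heis p m) : (heisExponent g).re ≤ 0 := by
  rw [heisExponent, Matrix.trace_sub, Matrix.trace_smul, trace_mul_conjTranspose, Complex.sub_re,
    trace_skewAdjoint_re, zero_sub, neg_nonpos]
  simp only [Complex.star_def, Complex.mul_conj, smul_eq_mul, ← Complex.ofReal_sum]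
  rw [show (1 / 2 : ℂ) = ((1 / 2 : ℝ) : ℂ) by norm_num, ← Complex.ofReal_mul, Complex.ofReal_re]
  exact mul_nonneg (by norm_num)
    (Finset.sum_nonneg fun i _ => Finset.sum_nonneg fun j _ => Complex.normSq_nonneg _)

-- The function f·1 is not in L², but its displacement is: one part involves the increment of f, the
-- other the displacement of the vacuum, and conditions (ii) and (iii) bound them separately.
omit [SigmaFinite ν] in
lemma memLp_vacuumFun_sub (hν : AlmostInvariant ν) (hf : CocycleConditions m ν f)
    (x : IwasawaGroup p m) :
    MemLp (transFun x (vacuumFun m f) - vacuumFun m f) 2 ν := by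
  have hm := (stronglyMeasurable_vacuumFun (m := m) hf.measurable).aestronglyMeasurable (μ := ν)
  refine ⟨(aestronglyMeasurable_transFun hν x hm).sub hm, ?_⟩
  rw [eLpNorm_two_lt_top_iff]
  have hpt : ∀ s, ‖(transFun x (vacuumFun m f) - vacuumFun m f) s‖ₑ ^ 2 ≤
      -- The factors come from (a + b)² ≤ 2a² + 2b²; the second gains another 2 from ‖U1 − 1‖² = 2c.
      2 * ENNReal.ofReal (|f (s * x.right) - f s| ^ 2) + 4 * ENNReal.ofReal
        ((1 - (Complex.exp (heisExponent (Heis.conj s x.left))).re) * f s ^ 2) := fun s => by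
    set U := heisK (Heis.conj s x.left)
    set c := 1 - (Complex.exp (heisExponent (Heis.conj s x.left))).re
    have hc : ‖U (bargmannOne p m) - bargmannOne p m‖ ^ 2 = 2 * c := norm_heisK_one_sub_sq _
    have hc0 : 0 ≤ c := by nlinarith [sq_nonneg ‖U (bargmannOne p m) - bargmannOne p m‖]
    have h1 : (transFun x (vacuumFun m f) - vacuumFun m f) s =
        ((f (s * x.right) - f s : ℝ) : ℂ) • U (bargmannOne p m) +
          (f s : ℂ) • (U (bargmannOne p m) - bargmannOne p m) := by
      simp only [Pi.sub_apply, transFun, vacuumFun, map_smul, U]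
      push_cast
      module
    have h2 : ‖(transFun x (vacuumFun m f) - vacuumFun m f) s‖ ^ 2 ≤
        2 * |f (s * x.right) - f s| ^ 2 + 4 * (c * f s ^ 2) := by
      rw [h1]
      refine (pow_le_pow_left₀ (norm_nonneg _) (norm_add_le _ _) 2).trans ?_
      rw [norm_smul, norm_smul, LinearIsometry.norm_map, norm_bargmannOne, mul_one,
        Complex.norm_real, Complex.norm_real, Real.norm_eq_abs, Real.norm_eq_abs]
      refine add_sq_le.trans (le_of_eq ?_)
      rw [mul_pow, hc, sq_abs (f s)]
      ring
    rw [← ofReal_norm, ← ENNReal.ofReal_pow (norm_nonneg _)]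
    refine (ENNReal.ofReal_le_ofReal h2).trans (le_of_eq ?_)
    rw [ENNReal.ofReal_add (by positivity) (by positivity), ENNReal.ofReal_mul (by norm_num),
      ENNReal.ofReal_mul (p := 4) (by norm_num)]
    simp
  refine (lintegral_mono hpt).trans_lt ?_
  have hm1 : Measurable fun s => 2 * ENNReal.ofReal (|f (s * x.right) - f s| ^ 2) := by
    refine (ENNReal.measurable_ofReal.comp (Measurable.pow_const ?_ 2)).const_mul 2
    exact continuous_abs.measurable.comp
      ((hf.measurable.comp (continuous_mul_const x.right).measurable).sub hf.measurable)
  rw [lintegral_add_left hm1, lintegral_const_mul' _ _ (by simp), lintegral_const_mul' _ _ (by simp)]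
  refine ENNReal.add_lt_top.2 ⟨ENNReal.mul_lt_top (by simp) (hf.translate _),
    ENNReal.mul_lt_top (by simp) ?_⟩
  simp only [heisExponent_conj]
  exact hf.heis x.left

/-- The cocycle `x ↦ T(x)(f 1) - f 1`. -/
noncomputable def iwasawaCocycle (hν : AlmostInvariant ν) (hf : CocycleConditions m ν f)
    (x : IwasawaGroup p m) : DirectIntegral m ν := (memLp_vacuumFun_sub hν hf x).toLp

omit [SigmaFinite ν] in
lemma iwasawaCocycle_ae (hν : AlmostInvariant ν) (hf : CocycleConditions m ν f)
    (x : IwasawaGroup p m) :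
    iwasawaCocycle hν hf x =ᵐ[ν] transFun x (vacuumFun m f) - vacuumFun m f :=
  (memLp_vacuumFun_sub hν hf x).coeFn_toLp

omit [SigmaFinite ν] in
lemma iwasawaCocycle_formula (hν : AlmostInvariant ν) (hf : CocycleConditions m ν f)
    (x : IwasawaGroup p m) : ∀ᵐ s ∂ν, ∀ᵐ z ∂(gauss p m),
      bargmannFun (iwasawaCocycle hν hf x s) z =
        actFun x (fun t _ => (f t : ℂ)) s z - (f s : ℂ) := by
  have hvac : ∀ s, bargmannFun (vacuumFun m f s) =ᵐ[gauss p m] fun _ => (f s : ℂ) := fun s => by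
    filter_upwards [bargmannFun_smul (f s : ℂ) (bargmannOne p m),
      bargmannFun_one (p := p) (m := m)] with z h1 h2
    rw [vacuumFun, h1, h2, mul_one]
  filter_upwards [iwasawaCocycle_ae hν hf x] with s hs
  rw [hs, Pi.sub_apply]
  filter_upwards [bargmannFun_sub (transFun x (vacuumFun m f) s) (vacuumFun m f s),
    bargmannFun_transFun x (vacuumFun m f) s, hvac s,
    heisOp_congr (Heis.conj s x.left) (hvac (s * x.right))] with z h1 h2 h3 h4
  rw [h1, h2, h3]
  congr 1

lemma iwasawaCocycle_mul (hν : AlmostInvariant ν) (hf : CocycleConditions m ν f)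
    (x y : IwasawaGroup p m) : iwasawaCocycle hν hf (x * y) =
      iwasawaRep hν x (iwasawaCocycle hν hf y) + iwasawaCocycle hν hf x := by
  refine Lp.ext ?_
  filter_upwards [iwasawaCocycle_ae hν hf (x * y), iwasawaCocycle_ae hν hf x,
    Lp.coeFn_add (iwasawaRep hν x (iwasawaCocycle hν hf y)) (iwasawaCocycle hν hf x),
    iwasawaRep_ae hν x (iwasawaCocycle hν hf y),
    transFun_congr hν x (iwasawaCocycle_ae hν hf y)] with s h1 h2 h3 h4 h5
  rw [h3, h1, Pi.add_apply, h2, h4, h5, transFun_mul, transFun_sub]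
  simp

/-- Moving f·1 to the side of W reduces this to the same Tonelli argument, which does not ask f·1 to
be square integrable. -/
lemma measurable_norm_iwasawaCocycle_sub (hν : AlmostInvariant ν) (hf : CocycleConditions m ν f)
    (W : DirectIntegral m ν) : Measurable fun x : IwasawaGroup p m => ‖iwasawaCocycle hν hf x - W‖ := by
  refine measurable_norm_of_enorm_sq (G := IwasawaGroup p m) (E := DirectIntegral m ν) ?_
  have h : ∀ x, ‖iwasawaCocycle hν hf x - W‖ₑ ^ 2 =
      ∫⁻ s, ‖transFun x (vacuumFun m f) s - (vacuumFun m f + W) s‖ₑ ^ 2 ∂ν := fun x => by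
    rw [enorm_sub_sq_eq_lintegral]
    refine lintegral_congr_ae ?_
    filter_upwards [iwasawaCocycle_ae hν hf x] with s hs
    rw [hs, Pi.sub_apply, Pi.add_apply, sub_sub]
  simp only [h]
  have hm := stronglyMeasurable_vacuumFun (m := m) hf.measurable
  exact measurable_lintegral_transFun hm (hm.add (Lp.stronglyMeasurable W))

lemma continuous_iwasawaCocycle (hν : AlmostInvariant ν) (hf : CocycleConditions m ν f) :
    Continuous (iwasawaCocycle hν hf) := by
  refine continuous_cocycle_of_measurable (G := IwasawaGroup p m) (H := DirectIntegral m ν)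
    (fun x => transLM hν x) (iwasawaCocycle hν hf) (transLM_one hν)
    (fun x => map_sub (transLM hν x)) (exists_norm_transLM_le hν) (fun v => ?_)
    (measurable_norm_iwasawaCocycle_sub hν hf) (iwasawaCocycle_mul hν hf)
  have h := measurable_norm_iwasawaRep_sub hν v 0
  simp only [sub_zero] at h
  exact h

/-- The central element `(i t, 0)` of `N`. -/
noncomputable def centralElement (p m : ℕ) (t : ℝ) : Heis p m where
  n := ⟨(t * Complex.I) • (1 : Matrix (Fin p) (Fin p) ℂ), by
    rw [skewAdjoint.mem_iff, Matrix.star_eq_conjTranspose, Matrix.conjTranspose_smul]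
    simp⟩
  z := 0

/-- Conjugation by s turns (it, 0) into (it ss*, 0), which has no translation part and so acts by
the exponential of its trace. -/
lemma heisK_conj_centralElement (s : lowerTri p) (t : ℝ) (φ : bargmann p m) :
    heisK (Heis.conj s (centralElement p m t)) φ =
      Complex.exp (t * (∑ i, ∑ j, ‖mat s i j‖ ^ 2 : ℝ) * Complex.I) • φ := by
  refine bargmann_ext ?_
  filter_upwards [bargmannFun_heisK (Heis.conj s (centralElement p m t)) φ,
    bargmannFun_smul (Complex.exp (t * (∑ i, ∑ j, ‖mat s i j‖ ^ 2 : ℝ) * Complex.I)) φ]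
    with z h1 h2
  have hz : (Heis.conj s (centralElement p m t)).z = 0 := Matrix.mul_zero _
  have hv : (Heis.conj s (centralElement p m t)).vec = 0 := hz
  have hn : ((Heis.conj s (centralElement p m t)).n : Matrix (Fin p) (Fin p) ℂ).trace =
      t * (∑ i, ∑ j, ‖mat s i j‖ ^ 2 : ℝ) * Complex.I := by
    change (mat s * ((t * Complex.I) • (1 : Matrix (Fin p) (Fin p) ℂ)) * (mat s)ᴴ).trace = _
    rw [Matrix.mul_smul, Matrix.mul_one, Matrix.smul_mul, Matrix.trace_smul,
      trace_mul_conjTranspose]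
    simp only [Complex.star_def, Complex.mul_conj, Complex.normSq_eq_norm_sq, smul_eq_mul]
    push_cast
    ring
  rw [h1, h2, heisOp_apply, heisMul, hz, hv]
  simp [hn]

lemma sum_norm_sq_mat_pos (hp : 1 ≤ p) (s : lowerTri p) : 0 < ∑ i, ∑ j, ‖mat s i j‖ ^ 2 := by
  have h : mat s ⟨0, hp⟩ ⟨0, hp⟩ ≠ 0 := fun h => by
    simpa [h] using mat_diag_pos s ⟨0, hp⟩
  have h' : 0 < ‖mat s ⟨0, hp⟩ ⟨0, hp⟩‖ ^ 2 := by positivity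
  refine Finset.sum_pos' (fun i _ => by positivity) ⟨⟨0, hp⟩, Finset.mem_univ _, ?_⟩
  exact Finset.sum_pos' (fun i _ => by positivity) ⟨⟨0, hp⟩, Finset.mem_univ _, h'⟩

/-- Otherwise r and √2 r would both be integer multiples of 2π, making √2 rational. Two fixed
parameters suffice for every r, so only two null sets of s are discarded later. -/
lemma eq_zero_of_exp_smul_eq {E : Type*} [AddCommGroup E] [Module ℂ E] {r : ℝ} (hr : r ≠ 0) {v : E}
    (h1 : Complex.exp ((1 : ℝ) * r * Complex.I) • v = v)
    (h2 : Complex.exp ((Real.sqrt 2 : ℝ) * r * Complex.I) • v = v) : v = 0 := by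
  by_contra hv
  have key : ∀ t : ℝ, Complex.exp (t * r * Complex.I) • v = v →
      ∃ n : ℤ, t * r = n * (2 * Real.pi) := fun t ht => by
    have h : Complex.exp (t * r * Complex.I) = 1 := by
      have : (Complex.exp (t * r * Complex.I) - 1) • v = 0 := by rw [sub_smul, ht, one_smul, sub_self]
      exact sub_eq_zero.1 ((smul_eq_zero.1 this).resolve_right hv)
    obtain ⟨n, hn⟩ := Complex.exp_eq_one_iff.1 h
    refine ⟨n, ?_⟩
    rw [← mul_assoc] at hn
    have := mul_right_cancel₀ Complex.I_ne_zero (hn.trans (by ring :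
      (n : ℂ) * (2 * Real.pi) * Complex.I = n * (2 * Real.pi) * Complex.I))
    exact_mod_cast this
  obtain ⟨k, hk⟩ := key 1 h1
  obtain ⟨l, hl⟩ := key (Real.sqrt 2) h2
  rw [one_mul] at hk
  rw [hk, ← mul_assoc] at hl
  have hl' : Real.sqrt 2 * k = l := mul_right_cancel₀ (by positivity) hl
  have hk0 : (k : ℝ) ≠ 0 := fun h => hr (by rw [hk, h, zero_mul])
  have hk0' : k ≠ 0 := by exact_mod_cast hk0
  refine (irrational_sqrt_two.mul_intCast hk0').ne_int l hl'

/-- A primitive ξ in L² would make f·1 − ξ a fixed function. The central elements force it to vanish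
almost everywhere, so f·1 would be square integrable. -/
theorem iwasawaCocycle_nontrivial (hp : 1 ≤ p) (hν : AlmostInvariant ν)
    (hf : CocycleConditions m ν f) :
    ¬ ∃ ξ, ∀ x, iwasawaCocycle hν hf x = iwasawaRep hν x ξ - ξ := by
  rintro ⟨ξ, hξ⟩
  have hinv : ∀ x : IwasawaGroup p m, ∀ᵐ s ∂ν,
      transFun x (vacuumFun m f - ξ) s = (vacuumFun m f - ξ) s := fun x => by
    have h := iwasawaCocycle_ae hν hf x
    rw [hξ] at h
    filter_upwards [h, Lp.coeFn_sub (iwasawaRep hν x ξ) ξ, iwasawaRep_ae hν x ξ] with s h1 h2 h3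
    rw [h2, Pi.sub_apply, h3, Pi.sub_apply] at h1
    rw [transFun_sub, Pi.sub_apply, Pi.sub_apply, sub_eq_sub_iff_sub_eq_sub, ← h1]
  have hcentral : ∀ t : ℝ, ∀ᵐ s ∂ν, Complex.exp (t * (∑ i, ∑ j, ‖mat s i j‖ ^ 2 : ℝ) * Complex.I) •
      (vacuumFun m f - ξ) s = (vacuumFun m f - ξ) s := fun t => by
    filter_upwards [hinv (SemidirectProduct.inl (centralElement p m t))] with s hs
    rw [← heisK_conj_centralElement]
    simpa [transFun] using hs
  have hzero : ∀ᵐ s ∂ν, ξ s = vacuumFun m f s := by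
    filter_upwards [hcentral 1, hcentral (Real.sqrt 2)] with s h1 h2
    exact (sub_eq_zero.1 (eq_zero_of_exp_smul_eq (sum_norm_sq_mat_pos hp s).ne' h1 h2)).symm
  refine (ENNReal.pow_lt_top (n := 2) (enorm_lt_top (x := ξ))).ne ?_
  rw [enorm_sq_eq_lintegral, ← hf.not_sq_integrable]
  refine lintegral_congr_ae ?_
  filter_upwards [hzero] with s hs
  rw [hs, enorm_vacuumFun_sq]

theorem isNontrivialCocycle_iwasawaCocycle (hp : 1 ≤ p) (hν : AlmostInvariant ν)
    (hf : CocycleConditions m ν f) :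
    IsNontrivialCocycle (G := IwasawaGroup p m) (H := DirectIntegral m ν)
      (iwasawaRep hν) (iwasawaCocycle hν hf) where
  continuous := continuous_iwasawaCocycle hν hf
  cocycle := iwasawaCocycle_mul hν hf
  nontrivial := iwasawaCocycle_nontrivial hp hν hf

end Cocycle

/-! ### A criterion for almost invariance. -/

section AlmostInvariant

variable {p : ℕ} {ν : Measure (lowerTri p)}

/-- Domination for every translation gives one absolute continuity directly and the converse by
pushing forward along the inverse translation. The derivative is bounded by comparing integrals over
sets. -/
lemma almostInvariant_of_map_le [SigmaFinite ν]
    (h : ∀ t : lowerTri p, ∃ C : ℝ≥0, ν.map (fun s => s * t) ≤ C • ν) : AlmostInvariant ν := by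
  have hm : ∀ t : lowerTri p, Measurable fun s : lowerTri p => s * t :=
    fun t => (continuous_mul_const t).measurable
  have hac : ∀ t : lowerTri p, ν.map (fun s => s * t) ≪ ν := fun t => by
    obtain ⟨C, hC⟩ := h t
    exact (Measure.absolutelyContinuous_of_le hC).trans Measure.smul_absolutelyContinuous
  refine fun t => ⟨hac t⁻¹, ?_, ?_⟩
  · have h1 := (hac t).map (hm t⁻¹)
    rw [Measure.map_map (hm _) (hm _)] at h1
    have h2 : ((fun s : lowerTri p => s * t⁻¹) ∘ fun s => s * t) = id := by
      funext s
      simp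
    rwa [h2, Measure.map_id] at h1
  · obtain ⟨C, hC⟩ := h t⁻¹
    refine ⟨C, ae_le_of_forall_setLIntegral_le_of_sigmaFinite (Measure.measurable_rnDeriv _ _)
      fun E _ _ => ?_⟩
    refine (Measure.setLIntegral_rnDeriv_le E).trans ((hC E).trans (le_of_eq ?_))
    rw [setLIntegral_const]
    rfl

end AlmostInvariant

/-! ### Estimates for the Hilbert–Schmidt norm. -/

section HsNorm

variable {p : ℕ}

lemma hsNorm_nonneg (s : lowerTri p) : 0 ≤ hsNorm s := Real.sqrt_nonneg _

lemma hsNorm_sq (s : lowerTri p) : hsNorm s ^ 2 = ∑ i, ∑ j, ‖mat s i j‖ ^ 2 :=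
  Real.sq_sqrt (by positivity)

lemma hsNorm_pos (hp : 1 ≤ p) (s : lowerTri p) : 0 < hsNorm s :=
  Real.sqrt_pos.2 (sum_norm_sq_mat_pos hp s)

lemma continuous_hsNorm : Continuous (hsNorm : lowerTri p → ℝ) := by
  have h : ∀ i j, Continuous fun s : lowerTri p => mat s i j :=
    fun i j => continuous_mat.matrix_elem i j
  exact Real.continuous_sqrt.comp (continuous_finsetSum _ fun i _ =>
    continuous_finsetSum _ fun j _ => (h i j).norm.pow 2)

lemma norm_mat_le_hsNorm (s : lowerTri p) (i j : Fin p) : ‖mat s i j‖ ≤ hsNorm s := by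
  refine Real.le_sqrt_of_sq_le ?_
  refine le_trans ?_ (Finset.single_le_sum (f := fun i => ∑ j, ‖mat s i j‖ ^ 2)
    (fun i _ => by positivity) (Finset.mem_univ i))
  exact Finset.single_le_sum (f := fun j => ‖mat s i j‖ ^ 2) (fun j _ => by positivity)
    (Finset.mem_univ j)

lemma hsNorm_le_of_forall_le {s : lowerTri p} {c : ℝ} (hc : 0 ≤ c)
    (h : ∀ i j, ‖mat s i j‖ ≤ c) : hsNorm s ≤ p * c := by
  refine Real.sqrt_le_iff.2 ⟨by positivity, ?_⟩
  calc ∑ i, ∑ j, ‖mat s i j‖ ^ 2 ≤ ∑ _i : Fin p, ∑ _j : Fin p, c ^ 2 := by gcongr; exact h _ _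
    _ = (p * c) ^ 2 := by simp; ring

lemma exists_hsNorm_mul_le (t : lowerTri p) :
    ∃ K : ℝ, 0 < K ∧ ∀ s : lowerTri p, hsNorm (s * t) ≤ K * hsNorm s := by
  -- Adding 1 keeps the constant positive even for p = 0.
  refine ⟨p * (p * hsNorm t) + 1, by have := hsNorm_nonneg t; positivity, fun s => ?_⟩
  have hs := hsNorm_nonneg s
  have ht := hsNorm_nonneg t
  have h : hsNorm (s * t) ≤ p * (p * (hsNorm s * hsNorm t)) := by
    refine hsNorm_le_of_forall_le (by positivity) fun i j => ?_
    rw [mat_mul, Matrix.mul_apply]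
    refine (norm_sum_le _ _).trans ?_
    calc ∑ k, ‖mat s i k * mat t k j‖ ≤ ∑ _k : Fin p, hsNorm s * hsNorm t := by
          gcongr with k
          rw [norm_mul]
          exact mul_le_mul (norm_mat_le_hsNorm s i k) (norm_mat_le_hsNorm t k j) (norm_nonneg _) hs
      _ = p * (hsNorm s * hsNorm t) := by simp
  linarith

lemma exists_norm_trace_conj_le (A : Matrix (Fin p) (Fin p) ℂ) :
    ∃ K : ℝ, 0 ≤ K ∧ ∀ s : lowerTri p, ‖(mat s * A * (mat s)ᴴ).trace‖ ≤ K * hsNorm s ^ 2 := by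
  refine ⟨∑ _i : Fin p, ∑ j, ∑ k, ‖A k j‖, by positivity, fun s => ?_⟩
  have hs := hsNorm_nonneg s
  rw [trace_mul_conjTranspose]
  simp only [Finset.sum_mul]
  refine (norm_sum_le _ _).trans (Finset.sum_le_sum fun i _ => ?_)
  refine (norm_sum_le _ _).trans (Finset.sum_le_sum fun j _ => ?_)
  rw [Matrix.mul_apply, Finset.sum_mul]
  refine (norm_sum_le _ _).trans (Finset.sum_le_sum fun k _ => ?_)
  rw [norm_mul, norm_mul, norm_star]
  calc ‖mat s i k‖ * ‖A k j‖ * ‖mat s i j‖ ≤ hsNorm s * ‖A k j‖ * hsNorm s := by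
        gcongr <;> exact norm_mat_le_hsNorm _ _ _
    _ = ‖A k j‖ * hsNorm s ^ 2 := by ring

/-- With the reverse estimate below, this lets radial integration use the norm of the coordinate
space in place of |s|. -/
lemma norm_coords_le (s : lowerTri p) : ‖coords s‖ ≤ hsNorm s := by
  refine norm_prod_le_iff.2 ⟨?_, ?_⟩
  · exact (pi_norm_le_iff_of_nonneg (hsNorm_nonneg s)).2 fun i =>
      (Complex.abs_re_le_norm _).trans (norm_mat_le_hsNorm s i i)
  · exact (pi_norm_le_iff_of_nonneg (hsNorm_nonneg s)).2 fun i => norm_mat_le_hsNorm s _ _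

lemma hsNorm_le_norm_coords (s : lowerTri p) : hsNorm s ≤ p * ‖coords s‖ := by
  refine hsNorm_le_of_forall_le (norm_nonneg _) fun i j => ?_
  rcases lt_trichotomy i j with h | rfl | h
  · rw [mat_eq_zero s h, norm_zero]
    exact norm_nonneg _
  · rw [mat_diag, Complex.norm_real]
    exact (norm_le_pi_norm (coords s).1 i).trans (norm_fst_le _)
  · exact (norm_le_pi_norm (coords s).2 ⟨(i, j), h⟩).trans (norm_snd_le _)

end HsNorm

/-! ### Lebesgue measure on `S` under right multiplication. -/

section Lebesgue

variable {p : ℕ}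

lemma measurableEmbedding_coords : MeasurableEmbedding (coords : lowerTri p → _) :=
  isOpenEmbedding_coords.measurableEmbedding

instance : SigmaFinite (lebesgue p) := by
  have : IsFiniteMeasureOnCompacts (lebesgue p) :=
    IsFiniteMeasureOnCompacts.comap' _ continuous_coords measurableEmbedding_coords
  infer_instance

instance : (volume : Measure (CoordSpace p)).IsAddHaarMeasure :=
  Measure.prod.instIsAddHaarMeasure _ _

lemma lebesgue_apply (E : Set (lowerTri p)) : lebesgue p E = volume (coords '' E) :=
  measurableEmbedding_coords.comap_apply _ _

lemma lintegral_lebesgue_le {G : CoordSpace p → ℝ≥0∞} (hG : Measurable G) :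
    ∫⁻ s, G (coords s) ∂(lebesgue p) ≤ ∫⁻ x, G x := by
  rw [← lintegral_map hG continuous_coords.measurable, lebesgue,
    measurableEmbedding_coords.map_comap]
  exact setLIntegral_le_lintegral _ _

lemma lebesgue_pos_of_isOpen {U : Set (lowerTri p)} (hU : IsOpen U) (hne : U.Nonempty) :
    lebesgue p U ≠ 0 := by
  rw [lebesgue_apply]
  exact (isOpenEmbedding_coords.isOpenMap U hU).measure_ne_zero _ (hne.image _)

/-- The right multiplication by `t ∈ S` in coordinates. -/
noncomputable def coordsMul (t : lowerTri p) : CoordSpace p →ₗ[ℝ] CoordSpace p :=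
  ofLower p ∘ₗ LinearMap.mulRight ℝ (mat t) ∘ₗ toLower p

lemma coords_mul (s t : lowerTri p) : coords (s * t) = coordsMul t (coords s) := by
  simp only [coordsMul, LinearMap.comp_apply, LinearMap.mulRight_apply, toLower_coords]
  rfl

/-- Right multiplication is linear in the coordinates, so it scales volume by a determinant.
Preimages under t are images under t⁻¹, hence the inverse. -/
lemma map_mul_right_lebesgue (t : lowerTri p) : (lebesgue p).map (fun s => s * t) =
    ENNReal.ofReal |LinearMap.det (coordsMul t⁻¹)| • lebesgue p := by
  ext E hE
  rw [Measure.map_apply (continuous_mul_const t).measurable hE, lebesgue_apply,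
    Measure.smul_apply, lebesgue_apply, smul_eq_mul, ← Measure.addHaar_image_linearMap]
  congr 1
  ext x
  constructor
  · rintro ⟨s, hs, rfl⟩
    exact ⟨_, ⟨s * t, hs, rfl⟩, by rw [← coords_mul, mul_inv_cancel_right]⟩
  · rintro ⟨_, ⟨s, hs, rfl⟩, rfl⟩
    exact ⟨s * t⁻¹, by simpa using hs, coords_mul s t⁻¹⟩

lemma lintegral_mul_right_lebesgue (t : lowerTri p) {F : lowerTri p → ℝ≥0∞} (hF : Measurable F) :
    ∫⁻ s, F (s * t) ∂(lebesgue p) =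
      ENNReal.ofReal |LinearMap.det (coordsMul t⁻¹)| * ∫⁻ s, F s ∂(lebesgue p) := by
  rw [← lintegral_map hF (continuous_mul_const t).measurable, map_mul_right_lebesgue,
    lintegral_smul_measure, smul_eq_mul]

lemma card_lower_mul_two (p : ℕ) :
    Fintype.card {ij : Fin p × Fin p // ij.2 < ij.1} * 2 = p * (p - 1) := by
  rw [← Finset.sum_range_id_mul_two, ← Fin.sum_univ_eq_sum_range, Fintype.card_subtype,
    Finset.card_filter, Fintype.sum_prod_type]
  congr 1
  refine Finset.sum_congr rfl fun i _ => ?_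
  rw [← Finset.card_filter]
  have : (Finset.univ.filter fun j : Fin p => j < i) = Finset.Iio i := by ext; simp
  rw [this, Fin.card_Iio]

/-- There are p real and p(p − 1)/2 complex coordinates. The total is the exponent in |s|^(-p²),
which makes the example measure invariant under homotheties. -/
lemma finrank_coordSpace (p : ℕ) : Module.finrank ℝ (CoordSpace p) = p ^ 2 := by
  rw [Module.finrank_prod, Module.finrank_pi, Module.finrank_pi_fintype]
  simp only [Complex.finrank_real_complex, Finset.sum_const, Finset.card_univ, smul_eq_mul,
    Fintype.card_fin]
  rw [card_lower_mul_two]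
  cases p with
  | zero => rfl
  | succ n => simp; ring

end Lebesgue

/-! ### The example: almost invariance and conditions (i)–(iii). -/

section Example

variable {p : ℕ}

/-- The density of the example measure. -/
noncomputable def exampleDensity (s : lowerTri p) : ℝ≥0∞ :=
  ENNReal.ofReal ((hsNorm s ^ (p ^ 2))⁻¹)

lemma measurable_exampleDensity : Measurable (exampleDensity : lowerTri p → ℝ≥0∞) :=
  ENNReal.measurable_ofReal.comp (continuous_hsNorm.measurable.pow_const _).inv

lemma exampleDensity_ne_zero (hp : 1 ≤ p) (s : lowerTri p) : exampleDensity s ≠ 0 := by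
  have := hsNorm_pos hp s
  exact (ENNReal.ofReal_pos.2 (by positivity)).ne'

instance : SigmaFinite (exampleMeasure p) := SigmaFinite.withDensity_ofReal _

lemma lintegral_exampleMeasure (F : lowerTri p → ℝ≥0∞) :
    ∫⁻ s, F s ∂(exampleMeasure p) = ∫⁻ s, exampleDensity s * F s ∂(lebesgue p) :=
  lintegral_withDensity_eq_lintegral_mul_non_measurable _ measurable_exampleDensity
    (Filter.Eventually.of_forall fun _ => ENNReal.ofReal_lt_top) F

lemma exists_exampleDensity_le (hp : 1 ≤ p) (t : lowerTri p) :
    ∃ C : ℝ≥0, ∀ s, exampleDensity s ≤ C * exampleDensity (s * t) := by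
  obtain ⟨K, hK, h⟩ := exists_hsNorm_mul_le t
  refine ⟨(K ^ (p ^ 2)).toNNReal, fun s => ?_⟩
  have hs := hsNorm_pos hp s
  have hst := hsNorm_pos hp (s * t)
  change ENNReal.ofReal _ ≤ ENNReal.ofReal (K ^ (p ^ 2)) * ENNReal.ofReal _
  rw [← ENNReal.ofReal_mul (by positivity)]
  refine ENNReal.ofReal_le_ofReal ?_
  rw [← div_eq_mul_inv, le_div_iff₀ (by positivity), inv_mul_le_iff₀ (by positivity), mul_comm,
    ← mul_pow]
  exact pow_le_pow_left₀ hst.le (h s) _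

theorem almostInvariant_exampleMeasure (hp : 1 ≤ p) : AlmostInvariant (exampleMeasure p) := by
  refine almostInvariant_of_map_le fun t => ?_
  obtain ⟨C, hC⟩ := exists_exampleDensity_le hp t
  refine ⟨C * |LinearMap.det (coordsMul t⁻¹)|.toNNReal, Measure.le_iff.2 fun E hE => ?_⟩
  have hm : Measurable fun s : lowerTri p => s * t := (continuous_mul_const t).measurable
  have hF : Measurable fun s : lowerTri p => exampleDensity s * E.indicator 1 s :=
    measurable_exampleDensity.mul (measurable_one.indicator hE)
  rw [← lintegral_indicator_one hE, lintegral_map (measurable_one.indicator hE) hm,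
    lintegral_exampleMeasure]
  calc ∫⁻ s, exampleDensity s * E.indicator 1 (s * t) ∂(lebesgue p)
      ≤ ∫⁻ s, C * (exampleDensity (s * t) * E.indicator 1 (s * t)) ∂(lebesgue p) := by
        refine lintegral_mono fun s => ?_
        rw [← mul_assoc]
        exact mul_le_mul_left (hC s) _
    _ = C * (ENNReal.ofReal |LinearMap.det (coordsMul t⁻¹)| *
          ∫⁻ s, exampleDensity s * E.indicator 1 s ∂(lebesgue p)) := by
        rw [lintegral_const_mul' _ _ ENNReal.coe_ne_top, lintegral_mul_right_lebesgue t hF]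
    _ = _ := by
        rw [← lintegral_exampleMeasure, lintegral_indicator_one hE, ← mul_assoc,
          Measure.smul_apply]
        rfl

/-- In polar coordinates the Jacobian r^(p²−1) and the density r^(-p²) leave dr/r; the factor r²
cures the origin and a multiple of ∫ r e^(-cr²) dr remains. -/
lemma lintegral_hsNorm_sq_mul_exp_lt_top (hp : 1 ≤ p) {c : ℝ} (hc : 0 < c) :
    ∫⁻ s : lowerTri p, ENNReal.ofReal (hsNorm s ^ 2 * Real.exp (-c * hsNorm s ^ 2))
      ∂(exampleMeasure p) < ∞ := by
  -- Radial majorant in y = ‖coords s‖: the lower bound y ≤ |s| serves the density and the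
  -- exponential, while |s| ≤ p y gives the factor p².
  let g : ℝ → ℝ := fun y => (y ^ (p ^ 2))⁻¹ * (p ^ 2 * (y ^ 2 * Real.exp (-c * y ^ 2)))
  have hg0 : ∀ y, 0 ≤ y → 0 ≤ g y := fun y hy => by positivity
  have hgm : Measurable g := by fun_prop
  have hint : Integrable (fun x : CoordSpace p => g ‖x‖) := by
    have : Nontrivial (CoordSpace p) := by
      have : Nonempty (Fin p) := ⟨⟨0, hp⟩⟩
      infer_instance
    rw [integrable_fun_norm_addHaar, finrank_coordSpace]
    refine (((integrable_mul_exp_neg_mul_sq hc).const_mul ((p : ℝ) ^ 2)).integrableOn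
      (s := Set.Ioi 0)).congr_fun (fun y hy => ?_) measurableSet_Ioi
    have hy0 : y ≠ 0 := (Set.mem_Ioi.1 hy).ne'
    have hp2 : p ^ 2 = p ^ 2 - 1 + 1 := (Nat.sub_add_cancel (Nat.one_le_pow _ _ hp)).symm
    simp only [g, smul_eq_mul]
    rw [show y ^ (p ^ 2) = y ^ (p ^ 2 - 1) * y by rw [← pow_succ, ← hp2]]
    field_simp
  refine lt_of_le_of_lt ?_ hint.lintegral_lt_top
  refine le_trans ?_ (lintegral_lebesgue_le (ENNReal.measurable_ofReal.comp
    (hgm.comp measurable_norm)))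
  rw [lintegral_exampleMeasure]
  refine lintegral_mono fun s => ?_
  rw [exampleDensity, ← ENNReal.ofReal_mul (by have := hsNorm_nonneg s; positivity)]
  refine ENNReal.ofReal_le_ofReal ?_
  have h1 := norm_coords_le s
  have h2 := hsNorm_le_norm_coords s
  have hs := hsNorm_pos hp s
  have hx : 0 < ‖coords s‖ := by
    by_contra! h
    have : (p : ℝ) * ‖coords s‖ ≤ 0 := mul_nonpos_of_nonneg_of_nonpos (by positivity) h
    linarith
  have h3 : hsNorm s ^ 2 ≤ p ^ 2 * ‖coords s‖ ^ 2 := by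
    rw [← mul_pow]
    exact pow_le_pow_left₀ hs.le h2 2
  calc (hsNorm s ^ (p ^ 2))⁻¹ * (hsNorm s ^ 2 * Real.exp (-c * hsNorm s ^ 2))
      ≤ (‖coords s‖ ^ (p ^ 2))⁻¹ *
          ((p ^ 2 * ‖coords s‖ ^ 2) * Real.exp (-c * ‖coords s‖ ^ 2)) := by
        gcongr ?_⁻¹ * (?_ * Real.exp ?_)
        · exact pow_le_pow_left₀ hx.le h1 _
        have := pow_le_pow_left₀ hx.le h1 2
        nlinarith
    _ = g ‖coords s‖ := by simp only [g]; ring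

lemma continuous_exampleFun : Continuous (exampleFun : lowerTri p → ℝ) := by
  unfold exampleFun
  have := continuous_hsNorm (p := p)
  fun_prop

lemma exampleFun_sq (s : lowerTri p) : exampleFun s ^ 2 = Real.exp (-hsNorm s ^ 2) := by
  rw [exampleFun, ← Real.exp_nat_mul]
  congr 1
  push_cast
  ring

/-- The scalar matrix `2` in `S`. -/
noncomputable def twoS (p : ℕ) : lowerTri p :=
  (exists_coords_eq (v := (fun _ => 2, 0)) fun _ => two_pos).choose

lemma coords_twoS : coords (twoS p) = (fun _ => 2, 0) :=
  (exists_coords_eq (v := (fun _ => 2, 0)) fun _ => two_pos).choose_spec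

lemma mat_twoS : mat (twoS p) = (2 : ℂ) • (1 : Matrix (Fin p) (Fin p) ℂ) := by
  rw [← toLower_coords, coords_twoS]
  ext i j
  simp only [toLower, LinearMap.coe_mk, AddHom.coe_mk, Matrix.of_apply, Matrix.smul_apply,
    Matrix.one_apply]
  rcases lt_trichotomy i j with h | rfl | h
  · simp [h.not_gt, h.ne]
  · simp
  · simp [h, h.ne']

lemma mat_inv_twoS : mat (twoS p)⁻¹ = (1 / 2 : ℂ) • (1 : Matrix (Fin p) (Fin p) ℂ) := by
  have h : mat (twoS p)⁻¹ * mat (twoS p) = 1 := by rw [← mat_mul, inv_mul_cancel, mat_one]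
  rw [mat_twoS, Matrix.mul_smul, Matrix.mul_one] at h
  rw [← h, smul_smul]
  norm_num

lemma hsNorm_mul_twoS (s : lowerTri p) : hsNorm (s * twoS p) = 2 * hsNorm s := by
  have h : hsNorm (s * twoS p) ^ 2 = (2 * hsNorm s) ^ 2 := by
    rw [mul_pow, hsNorm_sq, hsNorm_sq, mat_mul, mat_twoS, Matrix.mul_smul, Matrix.mul_one,
      Finset.mul_sum]
    simp [mul_pow, Finset.mul_sum]
  exact (pow_left_inj₀ (hsNorm_nonneg _) (by have := hsNorm_nonneg s; positivity) two_ne_zero).1 h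

lemma det_coordsMul_inv_twoS : LinearMap.det (coordsMul (twoS p)⁻¹) = (1 / 2 : ℝ) ^ (p ^ 2) := by
  have h : coordsMul (twoS p)⁻¹ = (1 / 2 : ℝ) • LinearMap.id := by
    refine LinearMap.ext fun v => ?_
    rw [coordsMul, LinearMap.comp_apply, LinearMap.comp_apply, LinearMap.mulRight_apply,
      mat_inv_twoS, Matrix.mul_smul, Matrix.mul_one]
    refine Prod.ext (funext fun i => ?_) (funext fun ij => ?_)
    · simp [ofLower, toLower]
    · simp [ofLower, toLower, ij.2]
  rw [h, LinearMap.det_smul, LinearMap.det_id, mul_one, finrank_coordSpace]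

lemma exampleDensity_mul_twoS (s : lowerTri p) :
    exampleDensity (s * twoS p) = ENNReal.ofReal ((1 / 2 : ℝ) ^ (p ^ 2)) * exampleDensity s := by
  rw [exampleDensity, exampleDensity, hsNorm_mul_twoS, ← ENNReal.ofReal_mul (by positivity),
    mul_pow, mul_inv, one_div, inv_pow]

/-- The example measure is invariant under homotheties. -/
lemma exampleMeasure_preimage_mul_twoS {E : Set (lowerTri p)} (hE : MeasurableSet E) :
    exampleMeasure p ((fun s => s * twoS p) ⁻¹' E) = exampleMeasure p E := by
  have hm : Measurable fun s : lowerTri p => s * twoS p :=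
    (continuous_mul_const (twoS p)).measurable
  have hF : Measurable fun s : lowerTri p => exampleDensity s * E.indicator 1 s :=
    measurable_exampleDensity.mul (measurable_one.indicator hE)
  set c : ℝ≥0∞ := ENNReal.ofReal ((1 / 2 : ℝ) ^ (p ^ 2)) with hc
  have hc0 : c ≠ 0 := (ENNReal.ofReal_pos.2 (by positivity)).ne'
  have hct : c ≠ ∞ := ENNReal.ofReal_ne_top
  rw [← lintegral_indicator_one (hm hE), ← lintegral_indicator_one hE, lintegral_exampleMeasure,
    lintegral_exampleMeasure]
  have h := lintegral_mul_right_lebesgue (twoS p) hF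
  rw [det_coordsMul_inv_twoS, abs_of_nonneg (by positivity), ← hc] at h
  simp only [exampleDensity_mul_twoS, ← hc, mul_assoc] at h
  rw [lintegral_const_mul' _ _ hct] at h
  exact (ENNReal.mul_right_inj hc0 hct).1 h

/-- If the integral were finite, all balls would have finite measure. Balls of radius r and 2r have
equal measure by homothety invariance, so the shell between them would be null, although it contains
a nonempty open set. -/
lemma lintegral_exampleFun_sq (hp : 1 ≤ p) :
    ∫⁻ s : lowerTri p, ENNReal.ofReal (exampleFun s ^ 2) ∂(exampleMeasure p) = ∞ := by
  by_contra hfin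
  have hm := continuous_hsNorm (p := p)
  let ρ := hsNorm (1 : lowerTri p)
  have hρ : 0 < ρ := hsNorm_pos hp 1
  let B : ℝ → Set (lowerTri p) := fun r => {s | hsNorm s < r}
  have hB : ∀ r, MeasurableSet (B r) := fun r => measurableSet_lt hm.measurable measurable_const
  have hfinB : ∀ r, exampleMeasure p (B r) ≠ ∞ := fun r htop => by
    refine hfin (top_unique ?_)
    calc (∞ : ℝ≥0∞) = ENNReal.ofReal (Real.exp (-r ^ 2)) * exampleMeasure p (B r) := by
          rw [htop, ENNReal.mul_top (ENNReal.ofReal_pos.2 (Real.exp_pos _)).ne']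
      _ = ∫⁻ _s in B r, ENNReal.ofReal (Real.exp (-r ^ 2)) ∂(exampleMeasure p) := by
          rw [setLIntegral_const]
      _ ≤ ∫⁻ s in B r, ENNReal.ofReal (exampleFun s ^ 2) ∂(exampleMeasure p) := by
          refine setLIntegral_mono' (hB r) fun s hs => ENNReal.ofReal_le_ofReal ?_
          rw [exampleFun_sq, Real.exp_le_exp, neg_le_neg_iff]
          exact pow_le_pow_left₀ (hsNorm_nonneg s) (le_of_lt hs) 2
      _ ≤ _ := setLIntegral_le_lintegral _ _
  -- The radii have ratio 2 and lie on either side of ρ = |1|, so the identity matrix witnesses that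
  -- the open shell is nonempty.
  have hscale : exampleMeasure p (B (ρ * (3 / 4))) = exampleMeasure p (B (ρ * (3 / 2))) := by
    rw [← exampleMeasure_preimage_mul_twoS (hB (ρ * (3 / 2)))]
    congr 1
    ext s
    simp only [B, Set.mem_preimage, Set.mem_ofPred_eq, hsNorm_mul_twoS]
    constructor <;> intro h <;> linarith
  have hsub : B (ρ * (3 / 4)) ⊆ B (ρ * (3 / 2)) := fun s hs => by
    simp only [B, Set.mem_ofPred_eq] at hs ⊢
    linarith
  have hdiff := measure_sdiff hsub (hB _).nullMeasurableSet (hfinB _)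
  rw [hscale, tsub_self] at hdiff
  let U : Set (lowerTri p) := {s | ρ * (3 / 4) < hsNorm s} ∩ {s | hsNorm s < ρ * (3 / 2)}
  have hU : IsOpen U := (isOpen_lt continuous_const hm).inter (isOpen_lt hm continuous_const)
  have hUne : U.Nonempty := by
    refine ⟨1, ?_, ?_⟩ <;> simp only [Set.mem_ofPred_eq] <;> linarith
  refine lebesgue_pos_of_isOpen hU hUne ?_
  have hac : lebesgue p ≪ exampleMeasure p :=
    withDensity_absolutelyContinuous' measurable_exampleDensity.aemeasurable
      (Filter.Eventually.of_forall (exampleDensity_ne_zero hp))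
  refine hac (measure_mono_null (fun s hs => ?_) hdiff)
  exact ⟨hs.2, fun h => lt_irrefl _ (lt_trans (show hsNorm s < _ from h) hs.1)⟩

/-- One factor of the square is estimated by the Lipschitz bound, giving smallness at the origin,
and the other by e^(-x), giving decay at infinity. -/
lemma abs_exp_neg_sub_sq_le {a b x : ℝ} (hx : 0 ≤ x) (ha : x ≤ a) (hb : x ≤ b) :
    |Real.exp (-a) - Real.exp (-b)| ^ 2 ≤ |a - b| * Real.exp (-x) := by
  wlog h : a ≤ b generalizing a b
  · rw [abs_sub_comm, abs_sub_comm a b]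
    exact this hb ha (le_of_not_ge h)
  have h0 : 0 ≤ Real.exp (-a) - Real.exp (-b) :=
    sub_nonneg.2 (Real.exp_le_exp.2 (neg_le_neg h))
  have ha1 : Real.exp (-a) ≤ Real.exp (-x) := Real.exp_le_exp.2 (neg_le_neg ha)
  have hb0 := Real.exp_pos (-b)
  have h1 : Real.exp (-a) - Real.exp (-b) ≤ b - a := by
    have e1 : Real.exp (-b) = Real.exp (-a) * Real.exp (-(b - a)) := by
      rw [← Real.exp_add]; congr 1; ring
    have e2 := Real.add_one_le_exp (-(b - a))
    have e3 : Real.exp (-a) ≤ 1 := Real.exp_le_one_iff.2 (by linarith)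
    have e4 := Real.exp_pos (-a)
    rw [e1]
    nlinarith
  rw [abs_of_nonneg h0, abs_sub_comm, abs_of_nonneg (sub_nonneg.2 h), sq]
  exact mul_le_mul h1 (by linarith) h0 (by linarith)

/-- For |w| ≤ 1 this is the bound on |e^w − 1|; for larger w the left side is at most 2 because
|e^w| ≤ 1. -/
lemma one_sub_re_exp_le {w : ℂ} (hw : w.re ≤ 0) : 1 - (Complex.exp w).re ≤ 2 * ‖w‖ := by
  have h : ‖Complex.exp w‖ ≤ 1 := by
    rw [Complex.norm_exp]
    exact Real.exp_le_one_iff.2 hw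
  by_cases h1 : ‖w‖ ≤ 1
  · have h2 := Complex.norm_exp_sub_one_le h1
    have h3 := (abs_le.1 (Complex.abs_re_le_norm (Complex.exp w - 1))).1
    rw [Complex.sub_re, Complex.one_re] at h3
    linarith
  · have h2 := (abs_le.1 (Complex.abs_re_le_norm (Complex.exp w))).1
    linarith

lemma lintegral_lt_top_of_le_hsNorm (hp : 1 ≤ p) {F : lowerTri p → ℝ} {C c : ℝ} (hC : 0 ≤ C)
    (hc : 0 < c) (h : ∀ s, F s ≤ C * (hsNorm s ^ 2 * Real.exp (-c * hsNorm s ^ 2))) :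
    ∫⁻ s, ENNReal.ofReal (F s) ∂(exampleMeasure p) < ∞ := by
  refine (lintegral_mono fun s => ENNReal.ofReal_le_ofReal (h s)).trans_lt ?_
  simp only [ENNReal.ofReal_mul hC]
  rw [lintegral_const_mul' _ _ ENNReal.ofReal_ne_top]
  exact ENNReal.mul_lt_top ENNReal.ofReal_lt_top (lintegral_hsNorm_sq_mul_exp_lt_top hp hc)

lemma lintegral_exampleFun_translate (hp : 1 ≤ p) (t : lowerTri p) :
    ∫⁻ s, ENNReal.ofReal (|exampleFun (s * t) - exampleFun s| ^ 2) ∂(exampleMeasure p) < ∞ := by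
  obtain ⟨K, hK, h1⟩ := exists_hsNorm_mul_le t
  obtain ⟨L, hL, h2⟩ := exists_hsNorm_mul_le t⁻¹
  -- C bounds half the difference of |st|² and |s|². Since |s|² ≤ L²|st|², the choice of c puts
  -- c|s|² below both |st|²/2 and |s|²/2; the +1 handles both at once and avoids a zero denominator.
  refine lintegral_lt_top_of_le_hsNorm hp (C := (K ^ 2 + 1) / 2) (c := 1 / (2 * (L ^ 2 + 1)))
    (by positivity) (by positivity) fun s => ?_
  have hs := hsNorm_nonneg s
  have hst := hsNorm_nonneg (s * t)
  have e1 : hsNorm (s * t) ^ 2 ≤ K ^ 2 * hsNorm s ^ 2 := by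
    rw [← mul_pow]
    exact pow_le_pow_left₀ hst (h1 s) 2
  have e2 : hsNorm s ^ 2 ≤ L ^ 2 * hsNorm (s * t) ^ 2 := by
    rw [← mul_pow]
    have := h2 (s * t)
    rw [mul_inv_cancel_right] at this
    exact pow_le_pow_left₀ hs this 2
  have hbound := abs_exp_neg_sub_sq_le (a := hsNorm (s * t) ^ 2 / 2) (b := hsNorm s ^ 2 / 2)
    (x := 1 / (2 * (L ^ 2 + 1)) * hsNorm s ^ 2) (by positivity)
    (by rw [div_mul_eq_mul_div, div_le_div_iff₀ (by positivity) (by positivity)]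
        nlinarith [sq_nonneg (hsNorm (s * t))])
    (by rw [div_mul_eq_mul_div, div_le_div_iff₀ (by positivity) (by positivity)]
        nlinarith [mul_nonneg (sq_nonneg L) (sq_nonneg (hsNorm s))])
  simp only [exampleFun, neg_div]
  refine hbound.trans ?_
  rw [← mul_assoc, ← neg_mul]
  refine mul_le_mul_of_nonneg_right ?_ (Real.exp_pos _).le
  rw [abs_le]
  constructor <;> nlinarith [sq_nonneg (hsNorm (s * t)), sq_nonneg (hsNorm s)]

lemma lintegral_exampleFun_heis {m : ℕ} (hp : 1 ≤ p) (g : Heis p m) :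
    ∫⁻ s : lowerTri p, ENNReal.ofReal ((1 - (Complex.exp (Matrix.trace (mat s *
      ((g.n : Matrix (Fin p) (Fin p) ℂ) - (1 / 2 : ℂ) • (g.z * g.zᴴ)) * (mat s)ᴴ))).re) *
        exampleFun s ^ 2) ∂(exampleMeasure p) < ∞ := by
  obtain ⟨K, hK, h⟩ := exists_norm_trace_conj_le
    ((g.n : Matrix (Fin p) (Fin p) ℂ) - (1 / 2 : ℂ) • (g.z * g.zᴴ))
  -- The trace is at most K|s|² in modulus and has nonpositive real part, so 1 − Re exp is at most
  -- 2K|s|².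
  refine lintegral_lt_top_of_le_hsNorm hp (C := 2 * K) (c := 1) (by positivity) one_pos
    fun s => ?_
  have hre := heisExponent_re_nonpos (Heis.conj s g)
  rw [heisExponent_conj] at hre
  rw [exampleFun_sq, neg_one_mul, ← mul_assoc]
  refine mul_le_mul_of_nonneg_right ?_ (Real.exp_pos _).le
  linarith [one_sub_re_exp_le hre, h s]

theorem cocycleConditions_exampleFun (m : ℕ) (hp : 1 ≤ p) :
    CocycleConditions m (exampleMeasure p) exampleFun where
  measurable := continuous_exampleFun.measurable
  pos _ := Real.exp_pos _
  not_sq_integrable := lintegral_exampleFun_sq hp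
  translate := lintegral_exampleFun_translate hp
  heis := lintegral_exampleFun_heis hp

end Example

end Iwasawa

theorem theorem9 (p q : ℕ) (hp : 1 ≤ p) (hpq : p ≤ q) :
    (∀ (ν : MeasureTheory.Measure (Iwasawa.lowerTri p)), MeasureTheory.SigmaFinite ν →
      Iwasawa.AlmostInvariant ν →
      ∀ f : Iwasawa.lowerTri p → ℝ, Iwasawa.CocycleConditions (q - p) ν f →
        ∃ T : Iwasawa.IwasawaGroup p (q - p) →*
            (Iwasawa.DirectIntegral (q - p) ν →L[ℂ] Iwasawa.DirectIntegral (q - p) ν),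
          Iwasawa.IsAssociatedRep ν T ∧
          (∀ T' : Iwasawa.IwasawaGroup p (q - p) →*
            (Iwasawa.DirectIntegral (q - p) ν →L[ℂ] Iwasawa.DirectIntegral (q - p) ν),
            Iwasawa.IsAssociatedRep ν T' → T' = T) ∧
          (∃ β : Iwasawa.IwasawaGroup p (q - p) → Iwasawa.DirectIntegral (q - p) ν,
            (∀ x, ∀ᵐ s ∂ν, ∀ᵐ z ∂(Iwasawa.gauss p (q - p)),
              Iwasawa.bargmannFun (β x s) z =
                Iwasawa.actFun x (fun t _ => (f t : ℂ)) s z - (f s : ℂ)) ∧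
            Iwasawa.IsNontrivialCocycle (G := Iwasawa.IwasawaGroup p (q - p))
              (H := Iwasawa.DirectIntegral (q - p) ν) T β) ∧
          Iwasawa.IsSpecial (G := Iwasawa.IwasawaGroup p (q - p))
            (H := Iwasawa.DirectIntegral (q - p) ν) T) ∧
    (MeasureTheory.SigmaFinite (Iwasawa.exampleMeasure p) ∧
      Iwasawa.AlmostInvariant (Iwasawa.exampleMeasure p) ∧
      Iwasawa.CocycleConditions (q - p) (Iwasawa.exampleMeasure p) Iwasawa.exampleFun) := by

  refine ⟨fun ν hσ hν f hf => ?_, inferInstance,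
    Iwasawa.almostInvariant_exampleMeasure hp, Iwasawa.cocycleConditions_exampleFun (q - p) hp⟩
  have hβ := Iwasawa.isNontrivialCocycle_iwasawaCocycle hp hν hf
  exact ⟨Iwasawa.iwasawaRep hν, Iwasawa.isAssociatedRep_iwasawaRep hν,
    fun T' hT' => hT'.unique (Iwasawa.isAssociatedRep_iwasawaRep hν),
    ⟨Iwasawa.iwasawaCocycle hν hf, Iwasawa.iwasawaCocycle_formula hν hf, hβ⟩,
    Iwasawa.stronglyContinuous_iwasawaRep hν, _, hβ⟩
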